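/- Let $(R,\mathfrak m)$ be a Noetherian local domain of Krull dimension one with fraction field $Q$, and let $\hat R$ be its $\mathfrak m$-adic completion. Let $E$ be an injective hull of the residue field of $R$ over $R$, and let $E'$ be an injective hull of the residue field of $\hat R$ over $\hat R$. Write $D_R(X)=\operatorname{Hom}_R(X,E)$ for an $R$-module $X$ and $D_{\hat R}(Y)=\operatorname{Hom}_{\hat R}(Y,E')$ for an $\hat R$-module $Y$. Every element of $E$ is annihilated by a power of $\mathfrak m$, so $E$ is an $\hat R$-module in a natural way, and hence so is $D_R(Q)$. Then: 1. $D_{\hat R}(D_R(Q))\cong Q\otimes_R\hat R$ as $\hat R$-modules, and $Q\otimes_R\hat R\cong Q\oplus \hat R/R$ as $R$-modules. 2. $\hat R/R\cong \operatorname{Ext}^1_R(Q,R)$ as $R$-modules. 3. The $R$-module structure of $\hat R/R$ extends to one and only one $Q$-vector space structure, and $\hat R/R$ is an injective $R$-module. 4. $R$ is complete (that is, $\mathfrak m$-adically complete and separated) if and only if $\operatorname{Ext}^1_R(Q,R)=0$, if and only if $D_R(Q)\cong Q$ as $R$-modules. -/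

import Mathlib

universe u v w

/-- `E` is an injective hull of the `R`-module `M`: an injective module into which `M` embeds as
an essential submodule (every nonzero submodule of `E` meets the image of `M` nontrivially). -/
class IsInjectiveHull (R : Type u) [CommRing R] (M : Type v) [AddCommGroup M] [Module R M]
    (E : Type w) [AddCommGroup E] [Module R E] : Prop where
  injective : Module.Injective R E
  exists_essential : ∃ f : M →ₗ[R] E, Function.Injective f ∧
    ∀ N : Submodule R E, N ≠ ⊥ → N ⊓ LinearMap.range f ≠ ⊥

/-- The Matlis dual `D_R(X) = Hom_R(X, E)` of a module `X` over a local ring `R`, where `E` is an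
injective hull of the residue field of `R`. -/
abbrev MatlisDual (R : Type u) [CommRing R] [IsLocalRing R]
    (E : Type w) [AddCommGroup E] [Module R E] [IsInjectiveHull R (IsLocalRing.ResidueField R) E]
    (X : Type v) [AddCommGroup X] [Module R X] : Type (max v w) :=
  X →ₗ[R] E

/-- The completion `R̂` of a local ring `R` with respect to its maximal ideal. -/
abbrev LocalCompletion (R : Type u) [CommRing R] [IsLocalRing R] : Type u :=
  AdicCompletion (IsLocalRing.maximalIdeal R) R

/-- The `R`-module `R̂ / R`, the cokernel of the canonical map from `R` to its completion. -/
abbrev CompletionQuotient (R : Type u) [CommRing R] [IsLocalRing R] : Type u :=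
  LocalCompletion R ⧸ LinearMap.range (Algebra.linearMap R (LocalCompletion R))

/-- The `R`-module `Ext^n_R(M, N)`. -/
abbrev ModuleExt (R : Type u) [CommRing R] (M N : Type u) [AddCommGroup M] [Module R M]
    [AddCommGroup N] [Module R N] (n : ℕ) : Type u :=
  CategoryTheory.Abelian.Ext (ModuleCat.of R M) (ModuleCat.of R N) n

namespace AdicTorsion

variable {R : Type u} [CommRing R] {I : Ideal R} {E : Type w} [AddCommGroup E] [Module R E]

theorem exists_rep (n : ℕ) (a : AdicCompletion I R) :
    ∃ r : R, Ideal.Quotient.mk (I ^ n) r = AdicCompletion.evalₐ I n a :=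
  Ideal.Quotient.mk_surjective _

theorem rep_mono {m n : ℕ} (h : m ≤ n) {a : AdicCompletion I R} {r : R}
    (hr : Ideal.Quotient.mk (I ^ n) r = AdicCompletion.evalₐ I n a) :
    Ideal.Quotient.mk (I ^ m) r = AdicCompletion.evalₐ I m a := by
  induction a using AdicCompletion.induction_on with
  | _ f =>
    rw [AdicCompletion.evalₐ_mk] at hr ⊢
    have h1 := Ideal.Quotient.eq.mp hr
    have h2 := Ideal.Quotient.eq.mp (AdicCompletion.Ideal.mk_eq_mk I h f)
    refine Ideal.Quotient.eq.mpr ?_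
    have := add_mem (Ideal.pow_le_pow_right h h1) h2
    simpa using this

/-- The action of `a` in the `I`-adic completion of `R` on an `I`-power torsion module: if
`I ^ n` kills `x`, then `a • x = r • x` for any `r : R` that agrees with `a` modulo `I ^ n`. -/
noncomputable def smul (h : ∀ x : E, ∃ n : ℕ, ∀ c ∈ I ^ n, c • x = 0)
    (a : AdicCompletion I R) (x : E) : E :=
  (exists_rep (h x).choose a).choose • x

theorem smul_eq (h : ∀ x : E, ∃ n : ℕ, ∀ c ∈ I ^ n, c • x = 0)
    (a : AdicCompletion I R) (x : E) {n : ℕ} (hn : ∀ c ∈ I ^ n, c • x = 0) {r : R}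
    (hr : Ideal.Quotient.mk (I ^ n) r = AdicCompletion.evalₐ I n a) :
    smul h a x = r • x := by
  unfold smul
  have hm := (h x).choose_spec
  have hs := (exists_rep (h x).choose a).choose_spec
  generalize (exists_rep (h x).choose a).choose = s at *
  generalize (h x).choose = m at *
  rw [← sub_eq_zero, ← sub_smul]
  rcases le_total m n with hmn | hmn
  · exact hm _ (Ideal.Quotient.eq.mp (hs.trans (rep_mono hmn hr).symm))
  · exact hn _ (Ideal.Quotient.eq.mp ((rep_mono hmn hs).trans hr.symm))

/-- The module structure over the `I`-adic completion of `R` on an `I`-power torsion `R`-module. -/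
noncomputable abbrev module (h : ∀ x : E, ∃ n : ℕ, ∀ c ∈ I ^ n, c • x = 0) :
    Module (AdicCompletion I R) E where
  smul := smul h
  one_smul x := by
    obtain ⟨n, hn⟩ := h x
    exact (smul_eq h 1 x hn (r := 1) (by simp)).trans (one_smul R x)
  mul_smul a b x := by
    obtain ⟨n, hn⟩ := h x
    obtain ⟨r, hr⟩ := exists_rep n a
    obtain ⟨s, hs⟩ := exists_rep n b
    change smul h (a * b) x = smul h a (smul h b x)
    have hn' : ∀ c ∈ I ^ n, c • s • x = 0 := fun c hc => by
      rw [smul_comm, hn c hc, smul_zero]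
    rw [smul_eq h b x hn hs, smul_eq h a _ hn' hr,
      smul_eq h (a * b) x hn (r := r * s) (by simp [hr, hs]), mul_smul]
  smul_zero a := by
    change smul h a 0 = 0
    simp [smul]
  zero_smul x := by
    obtain ⟨n, hn⟩ := h x
    exact (smul_eq h 0 x hn (r := 0) (by simp)).trans (zero_smul R x)
  add_smul a b x := by
    obtain ⟨n, hn⟩ := h x
    obtain ⟨r, hr⟩ := exists_rep n a
    obtain ⟨s, hs⟩ := exists_rep n b
    change smul h (a + b) x = smul h a x + smul h b x
    rw [smul_eq h a x hn hr, smul_eq h b x hn hs,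
      smul_eq h (a + b) x hn (r := r + s) (by simp [hr, hs]), add_smul]
  smul_add a x y := by
    obtain ⟨m, hm⟩ := h x
    obtain ⟨n, hn⟩ := h y
    obtain ⟨r, hr⟩ := exists_rep (m + n) a
    have hx : ∀ c ∈ I ^ (m + n), c • x = 0 := fun c hc =>
      hm c (Ideal.pow_le_pow_right (Nat.le_add_right m n) hc)
    have hy : ∀ c ∈ I ^ (m + n), c • y = 0 := fun c hc =>
      hn c (Ideal.pow_le_pow_right (Nat.le_add_left n m) hc)
    have hxy : ∀ c ∈ I ^ (m + n), c • (x + y) = 0 := fun c hc => by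
      rw [smul_add, hx c hc, hy c hc, add_zero]
    change smul h a (x + y) = smul h a x + smul h a y
    rw [smul_eq h a x hx hr, smul_eq h a y hy hr, smul_eq h a _ hxy hr, smul_add]

end AdicTorsion

namespace IsInjectiveHull

variable {R : Type u} [CommRing R] [IsLocalRing R] [IsNoetherianRing R]
  {E : Type w} [AddCommGroup E] [Module R E]

theorem exists_pow_smul_eq_zero [h : IsInjectiveHull R (IsLocalRing.ResidueField R) E] (x : E) :
    ∃ n : ℕ, ∀ c ∈ IsLocalRing.maximalIdeal R ^ n, c • x = 0 := by
  obtain ⟨f, -, hf⟩ := h.exists_essential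
  have key : IsLocalRing.maximalIdeal R ≤
      Ideal.radical (LinearMap.ker (LinearMap.toSpanSingleton R E x)) := by
    intro c hc
    let g : ℕ →o Ideal R :=
      ⟨fun n => LinearMap.ker (LinearMap.toSpanSingleton R E (c ^ n • x)), by
        refine monotone_nat_of_le_succ fun n r hr => ?_
        simp only [LinearMap.mem_ker, LinearMap.toSpanSingleton_apply] at hr ⊢
        rw [pow_succ', mul_smul, smul_comm, hr, smul_zero]⟩
    obtain ⟨n, hn⟩ := monotone_stabilizes_iff_noetherian.mpr ‹IsNoetherianRing R› g
    refine ⟨n, ?_⟩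
    simp only [LinearMap.mem_ker, LinearMap.toSpanSingleton_apply]
    by_contra hne
    refine hf (Submodule.span R {c ^ n • x}) (by simpa using hne) ?_
    rw [eq_bot_iff]
    rintro y ⟨hy, k, rfl⟩
    obtain ⟨r, hr⟩ := Submodule.mem_span_singleton.mp hy
    have hk : c • k = 0 := by
      obtain ⟨k, rfl⟩ := IsLocalRing.residue_surjective k
      rw [Algebra.smul_def, IsLocalRing.ResidueField.algebraMap_eq,
        (IsLocalRing.residue_eq_zero_iff c).mpr hc, zero_mul]
    have h1 : r ∈ g (n + 1) := by
      simp only [g, OrderHom.coe_mk, LinearMap.mem_ker, LinearMap.toSpanSingleton_apply]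
      rw [pow_succ', mul_smul, smul_comm, hr, ← map_smul, hk, map_zero]
    rw [← hn (n + 1) (Nat.le_succ n)] at h1
    have h2 : r • c ^ n • x = 0 := by simpa [g] using h1
    rw [Submodule.mem_bot, ← hr, h2]
  obtain ⟨n, hn⟩ := Ideal.exists_pow_le_of_le_radical_of_fg key (IsNoetherian.noetherian _)
  exact ⟨n, fun c hc => by simpa using hn hc⟩

/-- The injective hull of the residue field of a Noetherian local ring `R` is a module over the
completion of `R`, each element being killed by a power of the maximal ideal. -/
noncomputable instance [IsInjectiveHull R (IsLocalRing.ResidueField R) E] :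
    Module (LocalCompletion R) E :=
  AdicTorsion.module exists_pow_smul_eq_zero

instance [IsInjectiveHull R (IsLocalRing.ResidueField R) E] :
    IsScalarTower R (LocalCompletion R) E :=
  IsScalarTower.of_algebraMap_smul fun r x => by
    obtain ⟨n, hn⟩ := exists_pow_smul_eq_zero (R := R) x
    exact AdicTorsion.smul_eq exists_pow_smul_eq_zero _ x hn (AdicCompletion.evalₐ_of _ n r).symm

end IsInjectiveHull

section

open IsLocalRing TensorProduct

/-! In dimension one every nonzero `s : R` satisfies `𝔪 ^ k ≤ (s)` for some `k`. Hence R̂ = R + sR̂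
and sR̂ ∩ R = sR, so `s` acts bijectively on R̂/R: this gives the unique Q-structure and, by Baer's
criterion, injectivity. It also gives Q = R[1/x] for any nonzero x in 𝔪. Since Q is injective, it
splits off from R̂ ⊗ Q, and a ⊗ q ↦ q[a] identifies the complement with R̂/R.

For the double dual, E' ≅ E over R̂ and End_R(E) = R̂. Let V be the maps Q → E vanishing at 1. Those
vanishing at x⁻ⁿ lie in xⁿV, and V is finitely generated over R̂ by a Nakayama argument over a
complete ring (`fg_vanishingAtOne`). A functional φ on D(Q) therefore has φ(V) killed by some xⁿ, so
it factors through evaluation at x⁻ⁿ and is an R̂-multiple of it (`exists_eq_smul_completionEval`).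

For Ext, the telescope presents Q as a quotient of free modules, so Ext¹(Q, R) is the module of
sequences b modulo those of the form cₙ - x cₙ₊₁. The map b ↦ ∑ xⁱbᵢ is onto R̂, and its value lies
in R exactly for those sequences.

If R is complete, the description of functionals on D(Q) forces an embedding Q → D(Q) to be onto.
Conversely, D(Q) ≅ Q makes Q × R̂/R embed in Q, and rank one leaves no room for R̂/R. -/

theorem exists_mem_maximalIdeal_ne_zero {R : Type u} [CommRing R] [IsLocalRing R] (hdim : ringKrullDim R = 1) :
    ∃ x ∈ maximalIdeal R, x ≠ 0 := by
  by_contra! h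
  have hf : IsField R := isField_iff_maximalIdeal_eq.mpr (eq_bot_iff.mpr fun x hx => h x hx)
  rw [ringKrullDim_eq_zero_of_isField hf] at hdim
  exact zero_ne_one hdim

theorem mem_pow_smul_top_of_evalₐ_eq_zero {R : Type u} [CommRing R]
    [IsLocalRing R] [IsNoetherianRing R] {n : ℕ} {a : LocalCompletion R}
    (h : AdicCompletion.evalₐ (maximalIdeal R) n a = 0) :
    a ∈ (maximalIdeal R ^ n • ⊤ : Submodule R (LocalCompletion R)) := by
  rw [AdicCompletion.pow_smul_top_eq_ker_eval (IsNoetherian.noetherian _), LinearMap.mem_ker]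
  exact (AdicCompletion.factor_evalₐ_eq_eval _ a (by simp)).symm.trans (by rw [h, map_zero])

/-! ### Approximation in the completion of a one-dimensional local domain. -/

section DimensionOne

variable {R : Type u} [CommRing R] [IsDomain R] [IsLocalRing R] [IsNoetherianRing R]

/-- A prime containing `s` is nonzero, hence maximal, so the radical of `(s)` contains 𝔪, which is
finitely generated. -/
theorem exists_maximalIdeal_pow_le_span (hdim : ringKrullDim R = 1) {s : R} (hs : s ≠ 0) :
    ∃ k : ℕ, maximalIdeal R ^ k ≤ Ideal.span {s} := by
  have : Ring.KrullDimLE 1 R := (Order.krullDimLE_iff 1 _).mpr hdim.le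
  refine Ideal.exists_pow_le_of_le_radical_of_fg ?_ (IsNoetherian.noetherian _)
  rw [Ideal.radical_eq_sInf]
  refine le_sInf fun P ⟨hP, hPp⟩ => ?_
  have hne : P ≠ ⊥ := by
    rintro rfl
    exact hs (by simpa using hP (Ideal.mem_span_singleton_self s))
  exact (eq_maximalIdeal (hPp.isMaximal_of_ne_bot hne)).ge

theorem exists_eq_div_pow (hdim : ringKrullDim R = 1) {Q : Type u} [Field Q] [Algebra R Q]
    [IsFractionRing R Q] {x : R} (hx : x ∈ maximalIdeal R) (q : Q) :
    ∃ (n : ℕ) (a : R), (algebraMap R Q x) ^ n * q = algebraMap R Q a := by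
  obtain ⟨a, s, hs, rfl⟩ := IsFractionRing.div_surjective (A := R) q
  obtain ⟨k, hk⟩ := exists_maximalIdeal_pow_le_span hdim (nonZeroDivisors.ne_zero hs)
  obtain ⟨b, hb⟩ := Ideal.mem_span_singleton'.mp (hk (Ideal.pow_mem_pow hx k))
  refine ⟨k, b * a, ?_⟩
  have hs' : algebraMap R Q s ≠ 0 :=
    IsFractionRing.to_map_ne_zero_of_mem_nonZeroDivisors hs
  rw [← map_pow, ← hb, map_mul, map_mul]
  field_simp

theorem smul_injective_localCompletion {s : R} (hs : s ≠ 0) :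
    Function.Injective fun a : LocalCompletion R => s • a := by
  have h : IsSMulRegular R s := fun a b h => mul_left_cancel₀ hs h
  have := h.of_flat (S := LocalCompletion R)
  intro a b hab
  exact this (by simpa [Algebra.smul_def] using hab)

/-- Take `r` congruent to `a` modulo a power of 𝔪 inside `(s)`; the error then lies in sR̂. -/
theorem exists_eq_algebraMap_add_smul (hdim : ringKrullDim R = 1) {s : R} (hs : s ≠ 0)
    (a : LocalCompletion R) :
    ∃ (r : R) (b : LocalCompletion R), a = algebraMap R (LocalCompletion R) r + s • b := by
  obtain ⟨k, hk⟩ := exists_maximalIdeal_pow_le_span hdim hs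
  obtain ⟨r, hr⟩ := AdicTorsion.exists_rep k a
  have h1 : a - algebraMap R (LocalCompletion R) r ∈
      (maximalIdeal R ^ k • ⊤ : Submodule R (LocalCompletion R)) := by
    refine mem_pow_smul_top_of_evalₐ_eq_zero ?_
    rw [map_sub, ← hr, AlgHom.commutes]
    exact sub_self _
  have h2 := Submodule.smul_mono_left hk h1
  rw [Submodule.ideal_span_singleton_smul] at h2
  obtain ⟨b, -, hb⟩ := h2
  exact ⟨r, b, by rw [show s • b = _ from hb]; ring⟩

/-- If `c` approximates `a` modulo `𝔪 ^ k ≤ (s)`, then `s * c - r` is a multiple of `s` in R;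
cancelling `s` in R̂ is allowed by flatness. -/
theorem mem_range_algebraMap_of_smul_mem (hdim : ringKrullDim R = 1) {s : R} (hs : s ≠ 0)
    {a : LocalCompletion R} {r : R} (h : s • a = algebraMap R (LocalCompletion R) r) :
    ∃ t : R, r = s * t ∧ a = algebraMap R (LocalCompletion R) t := by
  obtain ⟨k, hk⟩ := exists_maximalIdeal_pow_le_span hdim hs
  obtain ⟨c, hc⟩ := AdicTorsion.exists_rep k a
  have h1 := congrArg (AdicCompletion.evalₐ (maximalIdeal R) k) h
  rw [map_smul, ← hc, AlgHom.commutes] at h1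
  have h2 : s * c - r ∈ maximalIdeal R ^ k := Ideal.Quotient.eq.mp h1
  obtain ⟨d, hd⟩ := Ideal.mem_span_singleton'.mp (hk h2)
  have hr : r = s * (c - d) := by rw [mul_sub, mul_comm s d, hd]; ring
  refine ⟨c - d, hr, smul_injective_localCompletion hs ?_⟩
  simp only [h]
  rw [hr, map_mul, Algebra.smul_def]

theorem smul_bijective_completionQuotient (hdim : ringKrullDim R = 1) {s : R} (hs : s ≠ 0) :
    Function.Bijective fun a : CompletionQuotient R => s • a := by
  constructor
  · rw [show (fun a : CompletionQuotient R => s • a) = LinearMap.lsmul R _ s from rfl,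
      injective_iff_map_eq_zero]
    intro a ha
    obtain ⟨a, rfl⟩ := Submodule.Quotient.mk_surjective _ a
    rw [LinearMap.lsmul_apply, ← Submodule.Quotient.mk_smul, Submodule.Quotient.mk_eq_zero] at ha
    obtain ⟨r, hr⟩ := ha
    obtain ⟨t, -, ht⟩ := mem_range_algebraMap_of_smul_mem hdim hs hr.symm
    rw [Submodule.Quotient.mk_eq_zero]
    exact ⟨t, ht.symm⟩
  · intro a
    obtain ⟨a, rfl⟩ := Submodule.Quotient.mk_surjective _ a
    obtain ⟨r, b, rfl⟩ := exists_eq_algebraMap_add_smul hdim hs a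
    refine ⟨Submodule.Quotient.mk b, ?_⟩
    exact (Submodule.Quotient.eq _).mpr ⟨-r, by rw [Algebra.linearMap_apply, map_neg]; ring⟩

end DimensionOne

/-! ### Modules on which nonzero scalars act bijectively. -/

section TorsionFreeDivisible

variable {R : Type u} [CommRing R] {M : Type v} [AddCommGroup M] [Module R M]

/-- Pick a nonzero `s` in the ideal and solve `s • w = g s`. Multiplication by `w` extends `g`, as
one sees after multiplying by `s`. -/
theorem Module.Baer.of_smul_bijective (h : ∀ s : R, s ≠ 0 → Function.Bijective fun a : M => s • a) :
    Module.Baer R M := by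
  intro I g
  by_cases hI : I = ⊥
  · refine ⟨0, fun x hx => ?_⟩
    subst hI
    obtain rfl : x = 0 := hx
    exact (map_zero g).symm
  · obtain ⟨s, hs, hs0⟩ := Submodule.exists_mem_ne_zero_of_ne_bot hI
    obtain ⟨w, hw⟩ := (h s hs0).2 (g ⟨s, hs⟩)
    refine ⟨LinearMap.toSpanSingleton R M w, fun a ha => (h s hs0).1 ?_⟩
    simp only at hw
    simp only [LinearMap.toSpanSingleton_apply]
    rw [smul_comm, hw, ← map_smul, ← map_smul]
    congr 1
    ext
    exact mul_comm _ _

theorem existsUnique_module_of_smul_bijective [IsDomain R]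
    (h : ∀ s : R, s ≠ 0 → Function.Bijective fun a : M => s • a)
    (Q : Type u) [Field Q] [Algebra R Q] [IsFractionRing R Q] :
    ∃! _ : Module Q M, IsScalarTower R Q M := by
  have : IsLocalizedModule (nonZeroDivisors R) (LinearMap.id : M →ₗ[R] M) :=
    { map_units := fun s => (Module.End.isUnit_iff _).mpr (h s (nonZeroDivisors.ne_zero s.2))
      surj := fun y => ⟨(y, 1), by simp⟩
      exists_of_eq := fun h => ⟨1, by simpa using h⟩ }
  refine ⟨IsLocalizedModule.module (nonZeroDivisors R) (LinearMap.id : M →ₗ[R] M),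
    IsLocalizedModule.isScalarTower_module _ _, fun m' hm' => ?_⟩
  let m := IsLocalizedModule.module (A := Q) (nonZeroDivisors R) (LinearMap.id : M →ₗ[R] M)
  have hm : @IsScalarTower R Q M _ m.toSMul _ := IsLocalizedModule.isScalarTower_module _ _
  refine Module.ext' m' m fun q y => ?_
  obtain ⟨a, s, hs, rfl⟩ := IsFractionRing.div_surjective (A := R) q
  have hs0 := nonZeroDivisors.ne_zero hs
  have hs' : algebraMap R Q s ≠ 0 := IsFractionRing.to_map_ne_zero_of_mem_nonZeroDivisors hs
  have e : s • (algebraMap R Q a / algebraMap R Q s) = a • (1 : Q) := by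
    rw [Algebra.smul_def, Algebra.smul_def]; field_simp
  -- Multiplying by `s` clears the denominator, and both structures then reduce to the given action
  -- of `a`.
  refine (h s hs0).1 ?_
  have e1 := @smul_assoc _ _ _ _ m'.toSMul _ hm' s (algebraMap R Q a / algebraMap R Q s) y
  have e2 := @smul_assoc _ _ _ _ m.toSMul _ hm s (algebraMap R Q a / algebraMap R Q s) y
  refine e1.symm.trans (Eq.trans ?_ e2)
  rw [e]
  refine (@smul_assoc _ _ _ _ m'.toSMul _ hm' a (1 : Q) y).trans
    (Eq.trans ?_ (@smul_assoc _ _ _ _ m.toSMul _ hm a (1 : Q) y).symm)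
  rw [@one_smul _ _ _ m'.toMulAction, @one_smul _ _ _ m.toMulAction]

theorem smul_bijective_of_isFractionRing {Q : Type u} [Field Q] [Algebra R Q] [IsFractionRing R Q]
    [Module Q M] [IsScalarTower R Q M] (s : R) (hs : s ≠ 0) :
    Function.Bijective fun a : M => s • a := by
  have hs' : algebraMap R Q s ≠ 0 := by
    rwa [Ne, IsFractionRing.to_map_eq_zero_iff]
  have : (fun a : M => s • a) = fun a => algebraMap R Q s • a := by
    ext a; rw [algebraMap_smul]
  rw [this]
  exact MulAction.bijective₀ hs'

end TorsionFreeDivisible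

/-! ### A form of Nakayama's lemma over complete rings. -/

section Complete

variable {A : Type u} [CommRing A]

theorem mem_pow_smul_top_pi_iff {ι : Type*} [Finite ι] {J : Ideal A} {n : ℕ} {v : ι → A} :
    v ∈ (J ^ n • ⊤ : Submodule A (ι → A)) ↔ ∀ i, v i ∈ J ^ n := by
  classical
  have := Fintype.ofFinite ι
  constructor
  · intro hv i
    have h := Submodule.mem_map_of_mem (f := LinearMap.proj (R := A) (φ := fun _ => A) i) hv
    rw [Submodule.map_smul''] at h
    have h2 := Submodule.smul_mono (le_refl (J ^ n)) (le_top (a := Submodule.map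
      (LinearMap.proj (R := A) (φ := fun _ => A) i) ⊤)) h
    simpa using h2
  · intro hv
    rw [← (Pi.basisFun A ι).sum_repr v]
    exact sum_mem fun i _ => Submodule.smul_mem_smul (hv i) Submodule.mem_top

theorem IsPrecomplete.pi_self {ι : Type*} [Finite ι] (J : Ideal A) [IsPrecomplete J A] :
    IsPrecomplete J (ι → A) where
  prec' f hf := by
    have hf' : ∀ i, ∃ L : A, ∀ n, f n i ≡ L [SMOD (J ^ n • ⊤ : Submodule A A)] := fun i =>
      IsPrecomplete.prec' (I := J) (fun n => f n i) fun {m n} hmn => by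
        rw [SModEq.sub_mem]
        simpa using mem_pow_smul_top_pi_iff.mp (SModEq.sub_mem.mp (hf hmn)) i
    choose L hL using hf'
    refine ⟨L, fun n => SModEq.sub_mem.mpr (mem_pow_smul_top_pi_iff.mpr fun i => ?_)⟩
    simpa using SModEq.sub_mem.mp (hL i n)

/-- Over a ring that is complete for `J`, a finitely generated submodule that generates a
`J`-adically separated module modulo `J` is the whole module. -/
theorem Submodule.FG.eq_top_of_sup_smul_eq_top {M : Type v} [AddCommGroup M] [Module A M]
    {J : Ideal A} [IsPrecomplete J A] [IsHausdorff J M] {N : Submodule A M} (hN : N.FG)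
    (h : N ⊔ J • ⊤ = ⊤) : N = ⊤ := by
  obtain ⟨n, s, rfl⟩ := Submodule.fg_iff_exists_fin_generating_family.mp hN
  have := IsPrecomplete.pi_self (ι := Fin n) J
  have hs : Function.Surjective (Fintype.linearCombination A s) := by
    -- The source is a finite power of `A`, hence precomplete, and `M` is separated, so surjectivity
    -- can be tested modulo `J`.
    refine surjective_of_mkQ_comp_surjective (I := J) ?_
    intro y
    obtain ⟨y, rfl⟩ := Submodule.mkQ_surjective _ y
    obtain ⟨a, ha, b, hb, hab⟩ := Submodule.mem_sup.mp (h ▸ Submodule.mem_top (x := y))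
    rw [← Fintype.range_linearCombination] at ha
    obtain ⟨c, rfl⟩ := ha
    refine ⟨c, (Submodule.Quotient.eq _).mpr ?_⟩
    rw [← hab, sub_add_cancel_left]
    exact neg_mem hb
  rw [← Fintype.range_linearCombination, LinearMap.range_eq_top.mpr hs]

theorem IsHausdorff.of_injective {M N : Type*} [AddCommGroup M] [Module A M] [AddCommGroup N]
    [Module A N] {J : Ideal A} [hN : IsHausdorff J N] (f : M →ₗ[A] N) (hf : Function.Injective f) :
    IsHausdorff J M where
  haus' x hx := hf <| by
    rw [map_zero]
    refine hN.haus' _ fun n => ?_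
    have h := Submodule.mem_map_of_mem (f := f) (SModEq.zero.mp (hx n))
    rw [Submodule.map_smul''] at h
    exact SModEq.zero.mpr (Submodule.smul_mono le_rfl le_top h)

end Complete

/-! ### The completion is Noetherian. -/

section DimensionOne

variable {R : Type u} [CommRing R] [IsDomain R] [IsLocalRing R] [IsNoetherianRing R]

theorem algebraMap_mem_maximalIdeal_localCompletion {R : Type u} [CommRing R] [IsLocalRing R]
    [IsNoetherianRing R] {x : R} (hx : x ∈ maximalIdeal R) :
    algebraMap R (LocalCompletion R) x ∈ maximalIdeal (LocalCompletion R) := by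
  rw [AdicCompletion.maximalIdeal_eq_map]
  exact Ideal.mem_map_of_mem _ hx

/-- The ideals of the completion that contain a nonzero element of a one-dimensional local
domain `R` are extended from `R`. -/
theorem map_comap_localCompletion (hdim : ringKrullDim R = 1) {s : R} (hs : s ≠ 0)
    {P : Ideal (LocalCompletion R)} (hP : algebraMap R (LocalCompletion R) s ∈ P) :
    (P.comap (algebraMap R (LocalCompletion R))).map (algebraMap R (LocalCompletion R)) = P := by
  refine le_antisymm Ideal.map_comap_le fun a ha => ?_
  obtain ⟨r, b, rfl⟩ := exists_eq_algebraMap_add_smul hdim hs a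
  have h1 : s • b ∈ P := by
    rw [Algebra.smul_def]; exact P.mul_mem_right _ hP
  have hr := (P.add_mem_iff_left h1).mp ha
  refine add_mem (Ideal.mem_map_of_mem _ hr) ?_
  rw [Algebra.smul_def]
  exact Ideal.mul_mem_right _ _ (Ideal.mem_map_of_mem _ hP)

/-- By Cohen's theorem only primes P matter. If P contains `y`, it is extended from R. Otherwise
lift generators of P + (y) to a finitely generated N ≤ P; then P = N + yP, and Nakayama gives N = P.
-/
theorem isNoetherianRing_localCompletion (hdim : ringKrullDim R = 1) :
    IsNoetherianRing (LocalCompletion R) := by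
  obtain ⟨x, hx, hx0⟩ := exists_mem_maximalIdeal_ne_zero hdim
  set y := algebraMap R (LocalCompletion R) x with hy
  have hym := algebraMap_mem_maximalIdeal_localCompletion hx
  have fg_of_mem : ∀ P : Ideal (LocalCompletion R), y ∈ P → P.FG := fun P hP => by
    rw [← map_comap_localCompletion hdim hx0 hP]
    exact Ideal.FG.map (IsNoetherian.noetherian (P.comap (algebraMap R (LocalCompletion R)))) _
  refine IsNoetherianRing.of_prime fun P hP => ?_
  by_cases hyP : y ∈ P
  · exact fg_of_mem P hyP
  -- a finitely generated ideal `N ≤ P` with `P = N + y P`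
  have : ∃ N : Ideal (LocalCompletion R), N.FG ∧ N ≤ P ∧ P ≤ N ⊔ Ideal.span {y} := by
    obtain ⟨t, ht⟩ := fg_of_mem (P ⊔ Ideal.span {y})
      (Ideal.mem_sup_right (Ideal.mem_span_singleton_self y))
    have h1 : ∀ z : t, ∃ p ∈ P, (z : LocalCompletion R) - p ∈ Ideal.span {y} := fun z => by
      have hz : (z : LocalCompletion R) ∈ P ⊔ Ideal.span {y} := ht ▸ Ideal.subset_span z.2
      obtain ⟨p, hp, q, hq, hpq⟩ := Submodule.mem_sup.mp hz
      exact ⟨p, hp, by rw [← hpq]; simpa using hq⟩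
    choose p hp hpt using h1
    refine ⟨Ideal.span (Set.range p), Submodule.fg_span (Set.finite_range p),
      Ideal.span_le.mpr (by rintro _ ⟨z, rfl⟩; exact hp z), le_sup_left.trans (ht.ge.trans ?_)⟩
    refine Ideal.span_le.mpr fun z hz => ?_
    have := add_mem (Ideal.mem_sup_right (hpt ⟨z, hz⟩))
      (Ideal.mem_sup_left (Ideal.subset_span ⟨⟨z, hz⟩, rfl⟩) :
        p ⟨z, hz⟩ ∈ Ideal.span (Set.range p) ⊔ Ideal.span {y})
    simpa using this
  obtain ⟨N, hN, hNP, hPN⟩ := this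
  have haus : IsHausdorff (maximalIdeal (LocalCompletion R)) P :=
    IsHausdorff.of_injective P.subtype P.injective_subtype
  have hfg : (Submodule.comap P.subtype N).FG :=
    Submodule.fg_of_fg_map_injective P.subtype P.injective_subtype
      (by rwa [Submodule.map_comap_subtype, inf_eq_right.mpr hNP])
  have htop := hfg.eq_top_of_sup_smul_eq_top (J := maximalIdeal (LocalCompletion R)) <| by
    rw [eq_top_iff]
    rintro ⟨z, hz⟩ -
    obtain ⟨a, ha, b, hb, rfl⟩ := Submodule.mem_sup.mp (hPN hz)
    obtain ⟨c, rfl⟩ := Ideal.mem_span_singleton'.mp hb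
    have hc : c * y ∈ P := (P.add_mem_iff_right (hNP ha)).mp hz
    -- Primality with `y ∉ P` improves P ≤ N + (y) to P = N + yP.
    have hc' : c ∈ P := (hP.mem_or_mem hc).resolve_right hyP
    have : (⟨a + c * y, hz⟩ : P) = ⟨a, hNP ha⟩ + y • ⟨c, hc'⟩ := by
      ext; simp [mul_comm]
    rw [this]
    exact add_mem (Submodule.mem_sup_left ha)
      (Submodule.mem_sup_right (Submodule.smul_mem_smul hym Submodule.mem_top))
  rw [Submodule.comap_subtype_eq_top] at htop
  rwa [le_antisymm htop hNP]

end DimensionOne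

/-! ### Matlis duality for modules of finite length. -/

section MatlisDuality

variable {R : Type u} [CommRing R] {E : Type u} [AddCommGroup E] [Module R E]

theorem exact_lcomp_of_exact {A B C : Type u} [AddCommGroup A] [Module R A] [AddCommGroup B]
    [Module R B] [AddCommGroup C] [Module R C] {f : A →ₗ[R] B} {g : B →ₗ[R] C}
    (hg : Function.Surjective g) (h : Function.Exact f g) :
    Function.Exact (LinearMap.lcomp R E g) (LinearMap.lcomp R E f) := by
  intro φ
  constructor
  · intro hφ
    have hle : LinearMap.ker g ≤ LinearMap.ker φ := by
      rw [h.linearMap_ker_eq]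
      rintro _ ⟨a, rfl⟩
      exact LinearMap.congr_fun hφ a
    refine ⟨(LinearMap.ker g).liftQ φ hle ∘ₗ (g.quotKerEquivOfSurjective hg).symm.toLinearMap, ?_⟩
    ext b
    simp [LinearMap.quotKerEquivOfSurjective_symm_apply]
  · rintro ⟨ψ, rfl⟩
    ext a
    simp [h.apply_apply_eq_zero]

theorem lcomp_surjective_of_injective (hE : Module.Injective R E) {A B : Type u} [AddCommGroup A]
    [Module R A] [AddCommGroup B] [Module R B] {f : A →ₗ[R] B} (hf : Function.Injective f) :
    Function.Surjective (LinearMap.lcomp R E f) := fun g => by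
  obtain ⟨h, hh⟩ := hE.out f hf g
  exact ⟨h, LinearMap.ext hh⟩

theorem lcomp_injective_of_surjective {A B : Type u} [AddCommGroup A]
    [Module R A] [AddCommGroup B] [Module R B] {f : A →ₗ[R] B} (hf : Function.Surjective f) :
    Function.Injective (LinearMap.lcomp R E f) := fun g h hgh =>
  LinearMap.ext fun b => by
    obtain ⟨a, rfl⟩ := hf b
    exact LinearMap.congr_fun hgh a

theorem exists_quotient_hom_apply_one {J : Ideal R} {e : E} (he : ∀ c ∈ J, c • e = 0) :
    ∃ f : (R ⧸ J) →ₗ[R] E, f (Submodule.Quotient.mk 1) = e :=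
  ⟨Submodule.liftQ J (LinearMap.toSpanSingleton R E e) fun c hc => by simpa using he c hc, by
    rw [Submodule.liftQ_apply, LinearMap.toSpanSingleton_apply_one]⟩

variable [IsLocalRing R]

theorem maximalIdeal_smul_residueField {c : R} (hc : c ∈ maximalIdeal R) (k : ResidueField R) :
    c • k = 0 := by
  obtain ⟨k, rfl⟩ := IsLocalRing.residue_surjective k
  rw [Algebra.smul_def, IsLocalRing.ResidueField.algebraMap_eq,
    (IsLocalRing.residue_eq_zero_iff c).mpr hc, zero_mul]

/-- In an injective hull of the residue field, the elements killed by the maximal ideal are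
those of the residue field. -/
theorem mem_range_of_forall_maximalIdeal_smul_eq_zero {f : ResidueField R →ₗ[R] E}
    (hf : ∀ N : Submodule R E, N ≠ ⊥ → N ⊓ LinearMap.range f ≠ ⊥) {e : E}
    (he : ∀ c ∈ maximalIdeal R, c • e = 0) : e ∈ LinearMap.range f := by
  by_cases h0 : e = 0
  · rw [h0]; exact zero_mem _
  obtain ⟨y, ⟨hy, hyf⟩, hy0⟩ :=
    Submodule.exists_mem_ne_zero_of_ne_bot (hf (Submodule.span R {e}) (by simpa using h0))
  obtain ⟨r, rfl⟩ := Submodule.mem_span_singleton.mp hy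
  have hr : IsUnit r := by
    by_contra hr
    exact hy0 (he r ((mem_maximalIdeal r).mpr hr))
  have := Submodule.smul_mem (LinearMap.range f) ((hr.unit⁻¹ : Rˣ) : R) hyf
  rwa [smul_smul, IsUnit.val_inv_mul, one_smul] at this

/-- The cyclic module generated by `n` maps onto the residue field, which embeds in E; injectivity
extends this map to N. -/
theorem exists_hom_ne_zero [hE : IsInjectiveHull R (ResidueField R) E] {N : Type u}
    [AddCommGroup N] [Module R N] {n : N} (hn : n ≠ 0) : ∃ f : N →ₗ[R] E, f n ≠ 0 := by
  obtain ⟨i, hi, -⟩ := hE.exists_essential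
  have hle : Ideal.torsionOf R N n ≤ maximalIdeal R :=
    le_maximalIdeal ((Ideal.torsionOf_eq_top_iff R n).not.mpr hn)
  let q : (R ⧸ Ideal.torsionOf R N n) →ₗ[R] E :=
    i ∘ₗ Submodule.liftQ _ (Algebra.linearMap R (ResidueField R)) (fun c hc => by
      rw [LinearMap.mem_ker, Algebra.linearMap_apply, ResidueField.algebraMap_eq]
      exact (IsLocalRing.residue_eq_zero_iff c).mpr (hle hc))
  obtain ⟨h, hh⟩ := hE.injective.out (R ∙ n).subtype (R ∙ n).subtype_injective
    (q ∘ₗ (Ideal.quotTorsionOfEquivSpanSingleton R N n).symm.toLinearMap)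
  refine ⟨h, fun h0 => ?_⟩
  have h1 := hh ⟨n, Submodule.mem_span_singleton_self n⟩
  have h2 : (Ideal.quotTorsionOfEquivSpanSingleton R N n).symm
      ⟨n, Submodule.mem_span_singleton_self n⟩ = Submodule.Quotient.mk 1 := by
    rw [LinearEquiv.symm_apply_eq, Ideal.quotTorsionOfEquivSpanSingleton_apply_mk]
    simp
  simp only [Submodule.subtype_apply, h0, LinearMap.comp_apply, LinearEquiv.coe_coe, h2, q] at h1
  rw [Submodule.liftQ_apply] at h1
  have := hi (h1.symm.trans (map_zero i).symm)
  simp at this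

theorem dual_eval_injective [hE : IsInjectiveHull R (ResidueField R) E] (N : Type u)
    [AddCommGroup N] [Module R N] :
    Function.Injective (LinearMap.applyₗ (R := R) (M := N) (M₂ := E)) := by
  rw [injective_iff_map_eq_zero]
  intro n hn
  by_contra h
  obtain ⟨f, hf⟩ := exists_hom_ne_zero (R := R) (E := E) h
  exact hf (LinearMap.congr_fun hn f)

/-- A map from the residue field lands in the part of E killed by 𝔪, which is the residue field
itself. -/
theorem length_residueField_dual [hE : IsInjectiveHull R (ResidueField R) E] :
    Module.length R (ResidueField R →ₗ[R] E) = Module.length R (ResidueField R) := by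
  obtain ⟨i, hi, hess⟩ := hE.exists_essential
  let g : ResidueField R →ₗ[R] (ResidueField R →ₗ[R] E) :=
    LinearMap.compRight R i ∘ₗ LinearMap.mul R (ResidueField R)
  have hg : ∀ a b, g a b = i (a * b) := fun a b => rfl
  refine (LinearEquiv.ofBijective g ⟨fun a b hab => ?_, fun φ => ?_⟩).length_eq.symm
  · have h := LinearMap.congr_fun hab 1
    rw [hg, hg, mul_one, mul_one] at h
    exact hi h
  · obtain ⟨a, ha⟩ := mem_range_of_forall_maximalIdeal_smul_eq_zero hess (e := φ 1) fun c hc => by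
      rw [← map_smul, maximalIdeal_smul_residueField hc, map_zero]
    refine ⟨a, LinearMap.ext fun b => ?_⟩
    obtain ⟨r, rfl⟩ := IsLocalRing.residue_surjective b
    have hr : residue R r = r • (1 : ResidueField R) := (Algebra.algebraMap_eq_smul_one r)
    rw [hg, hr, map_smul, ← ha, ← map_smul, mul_smul_comm, mul_one]

/-- Matlis duality preserves lengths of modules of finite length. -/
theorem IsFiniteLength.length_matlisDual [hE : IsInjectiveHull R (ResidueField R) E] {N : Type u}
    [AddCommGroup N] [Module R N] (hN : IsFiniteLength R N) :
    Module.length R (N →ₗ[R] E) = Module.length R N := by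
  induction hN with
  | of_subsingleton => rw [Module.length_eq_zero, Module.length_eq_zero]
  | @of_simple_quotient M _ _ S hS _ ih =>
    rw [Module.length_eq_add_of_exact S.subtype S.mkQ S.subtype_injective S.mkQ_surjective
      (LinearMap.exact_subtype_mkQ S),
      Module.length_eq_add_of_exact (LinearMap.lcomp R E S.mkQ) (LinearMap.lcomp R E S.subtype)
      (lcomp_injective_of_surjective S.mkQ_surjective)
      (lcomp_surjective_of_injective hE.injective S.subtype_injective)
      (exact_lcomp_of_exact S.mkQ_surjective (LinearMap.exact_subtype_mkQ S)), ih, add_comm]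
    congr 1
    obtain ⟨I, hI, ⟨e⟩⟩ := isSimpleModule_iff_quot_maximal.mp hS
    obtain rfl := eq_maximalIdeal hI
    rw [e.length_eq, (e.congrLeft E R).length_eq]
    exact length_residueField_dual

/-- N embeds in its double dual, which has the same finite length, so the cokernel has length zero.
-/
theorem dual_eval_bijective [hE : IsInjectiveHull R (ResidueField R) E] {N : Type u}
    [AddCommGroup N] [Module R N] (hN : IsFiniteLength R N) :
    Function.Bijective (LinearMap.applyₗ (R := R) (M := N) (M₂ := E)) := by
  refine ⟨dual_eval_injective N, ?_⟩
  have h1 := hN.length_matlisDual (E := E)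
  have hN' : IsFiniteLength R (N →ₗ[R] E) := by
    rw [← Module.length_ne_top_iff, h1, Module.length_ne_top_iff]; exact hN
  have h2 := hN'.length_matlisDual (E := E)
  have h3 := Module.length_eq_add_of_exact (LinearMap.applyₗ (R := R) (M := N) (M₂ := E))
    (LinearMap.range (LinearMap.applyₗ (R := R) (M := N) (M₂ := E))).mkQ (dual_eval_injective N)
    (Submodule.mkQ_surjective _) (LinearMap.exact_map_mkQ_range _)
  rw [h2, h1] at h3
  have h4 := ENat.add_right_injective_of_ne_top (Module.length_ne_top_iff.mpr hN) ((add_zero _).trans h3)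
  have := Module.length_eq_zero_iff.mp h4.symm
  exact LinearMap.range_eq_top.mp (Submodule.Quotient.subsingleton_iff.mp this)

theorem isFiniteLength_quotient_maximalIdeal_pow [IsNoetherianRing R] {J : Ideal R} {n : ℕ}
    (hJ : maximalIdeal R ^ n ≤ J) : IsFiniteLength R (R ⧸ J) := by
  have : Ring.KrullDimLE 0 (R ⧸ J) := Ring.KrullDimLE.mk₀ fun P hP => by
    have h1 : (P.comap (Ideal.Quotient.mk J)).IsPrime := hP.comap _
    have h2 : maximalIdeal R ≤ P.comap (Ideal.Quotient.mk J) := by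
      refine h1.le_of_pow_le (n := n) (hJ.trans fun c hc => ?_)
      rw [Ideal.mem_comap, Ideal.Quotient.eq_zero_iff_mem.mpr hc]
      exact P.zero_mem
    have h3 := (maximalIdeal.isMaximal R).eq_of_le h1.ne_top h2
    have h4 : (P.comap (Ideal.Quotient.mk J)).IsMaximal := h3 ▸ maximalIdeal.isMaximal R
    exact Ideal.isMaximal_of_isIntegral_of_isMaximal_comap (R := R) P h4
  have : IsArtinianRing (R ⧸ J) :=
    isArtinianRing_iff_isNoetherianRing_krullDimLE_zero.mpr ⟨inferInstance, this⟩
  rw [← Module.length_ne_top_iff, Module.length_eq_of_surjective (R := R ⧸ J)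
    Ideal.Quotient.mk_surjective]
  exact Module.length_ne_top

/-- Elements of E killed by J are values at 1 of maps `R ⧸ J → E`, and such maps separate points of
`R ⧸ J`. -/
theorem mem_of_forall_torsion_smul_eq_zero [hE : IsInjectiveHull R (ResidueField R) E]
    {J : Ideal R} {r : R}
    (h : ∀ e : E, (∀ c ∈ J, c • e = 0) → r • e = 0) : r ∈ J := by
  rw [← Submodule.Quotient.mk_eq_zero]
  refine dual_eval_injective (R := R) (E := E) (R ⧸ J) ?_
  rw [map_zero]
  ext f
  have h1 : (Submodule.Quotient.mk r : R ⧸ J) = r • Submodule.Quotient.mk 1 := by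
    rw [← Submodule.Quotient.mk_smul, smul_eq_mul, mul_one]
  rw [LinearMap.applyₗ_apply_apply, h1, map_smul, LinearMap.zero_apply]
  refine h _ fun c hc => ?_
  rw [← map_smul, ← Submodule.Quotient.mk_smul, (Submodule.Quotient.mk_eq_zero J).mpr, map_zero]
  simpa using hc

end MatlisDuality

/-! ### Endomorphisms of E, and E as an injective hull over the completion. -/

section Completion

variable {R : Type u} [CommRing R] [IsLocalRing R] [IsNoetherianRing R]
  {E : Type u} [AddCommGroup E] [Module R E] [hE : IsInjectiveHull R (ResidueField R) E]

theorem completion_smul_eq {n : ℕ} {e : E} (he : ∀ c ∈ maximalIdeal R ^ n, c • e = 0) {r : R}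
    {a : LocalCompletion R}
    (h : Ideal.Quotient.mk (maximalIdeal R ^ n) r = AdicCompletion.evalₐ (maximalIdeal R) n a) :
    a • e = r • e :=
  AdicTorsion.smul_eq IsInjectiveHull.exists_pow_smul_eq_zero a e he h

/-- A linear endomorphism of `E` agrees on the `J`-torsion with a scalar, if `J` is primary to
the maximal ideal. -/
theorem exists_forall_torsion_apply_eq_smul {J : Ideal R} {n : ℕ} (hJ : maximalIdeal R ^ n ≤ J)
    (φ : E →ₗ[R] E) : ∃ r : R, ∀ e : E, (∀ c ∈ J, c • e = 0) → φ e = r • e := by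
  -- Composing φ with evaluation at 1 gives an element of the double dual of `R ⧸ J`, which
  -- reflexivity turns into a residue class.
  obtain ⟨q, hq⟩ := (dual_eval_bijective (E := E)
    (isFiniteLength_quotient_maximalIdeal_pow hJ)).2
    (φ ∘ₗ LinearMap.applyₗ (Submodule.Quotient.mk 1))
  obtain ⟨r, rfl⟩ := Submodule.Quotient.mk_surjective _ q
  refine ⟨r, fun e he => ?_⟩
  obtain ⟨f, rfl⟩ := exists_quotient_hom_apply_one he
  have h1 : (Submodule.Quotient.mk r : R ⧸ J) = r • Submodule.Quotient.mk 1 := by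
    rw [← Submodule.Quotient.mk_smul, smul_eq_mul, mul_one]
  have h := LinearMap.congr_fun hq f
  rw [h1, map_smul] at h
  exact h.symm

/-- The scalars by which φ acts on the `𝔪 ^ n`-torsion form a Cauchy sequence, because `𝔪 ^ n` is
the full annihilator of that torsion; these torsion parts exhaust E. -/
theorem exists_forall_apply_eq_completion_smul (φ : E →ₗ[R] E) :
    ∃ a : LocalCompletion R, ∀ e : E, φ e = a • e := by
  choose r hr using fun n : ℕ =>
    exists_forall_torsion_apply_eq_smul (le_refl (maximalIdeal R ^ n)) φ
  have hcauchy : ∀ {m n : ℕ}, m ≤ n → r m ≡ r n [SMOD (maximalIdeal R ^ m • ⊤ : Ideal R)] :=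
    fun {m n} hmn => by
      rw [SModEq.sub_mem, smul_eq_mul, Ideal.mul_top]
      refine mem_of_forall_torsion_smul_eq_zero (E := E) fun e he => ?_
      rw [sub_smul, ← hr m e he, ← hr n e fun c hc => he c (Ideal.pow_le_pow_right hmn hc),
        sub_self]
  refine ⟨AdicCompletion.mk _ _ ⟨r, hcauchy⟩, fun e => ?_⟩
  obtain ⟨n, hn⟩ := IsInjectiveHull.exists_pow_smul_eq_zero (R := R) e
  rw [hr n e hn]
  exact (completion_smul_eq hn
    (AdicCompletion.evalₐ_mk _ n ⟨r, hcauchy⟩).symm).symm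

theorem eq_zero_of_forall_completion_smul_eq_zero {a : LocalCompletion R}
    (h : ∀ e : E, a • e = 0) : a = 0 := by
  refine AdicCompletion.ext_evalₐ fun n => ?_
  obtain ⟨r, hr⟩ := AdicTorsion.exists_rep n a
  rw [← hr, map_zero]
  refine Ideal.Quotient.eq_zero_iff_mem.mpr
    (mem_of_forall_torsion_smul_eq_zero (E := E) fun e he => ?_)
  rw [← completion_smul_eq he hr, h]

theorem maximalIdeal_completion_smul_eq_zero {e : E} (he : ∀ c ∈ maximalIdeal R, c • e = 0)
    {a : LocalCompletion R} (ha : a ∈ maximalIdeal (LocalCompletion R)) : a • e = 0 := by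
  have h : maximalIdeal (LocalCompletion R) ≤ Ideal.torsionOf (LocalCompletion R) E e := by
    rw [AdicCompletion.maximalIdeal_eq_map, Ideal.map_le_iff_le_comap]
    intro c hc
    rw [Ideal.mem_comap, Ideal.mem_torsionOf_iff, algebraMap_smul]
    exact he c hc
  exact h ha

/-- The injective hull of the residue field of `R` is also one over the completion of `R`. -/
theorem nonempty_equiv_injectiveHull_completion [IsNoetherianRing (LocalCompletion R)]
    {E' : Type u} [AddCommGroup E'] [Module (LocalCompletion R) E']
    [hE' : IsInjectiveHull (LocalCompletion R) (ResidueField (LocalCompletion R)) E'] :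
    Nonempty (E' ≃ₗ[LocalCompletion R] E) := by
  let _ : Module R E' := Module.compHom E' (algebraMap R (LocalCompletion R))
  have _ : IsScalarTower R (LocalCompletion R) E' :=
    IsScalarTower.of_algebraMap_smul fun _ _ => rfl
  obtain ⟨i, hi, hess⟩ := hE.exists_essential
  obtain ⟨i', hi', hess'⟩ := hE'.exists_essential
  have hi0 : i 1 ≠ 0 := fun h => one_ne_zero (hi (h.trans (map_zero i).symm))
  obtain ⟨h, hh⟩ := exists_hom_ne_zero (R := LocalCompletion R) (E := E') hi0
  have hres : ∀ k : ResidueField R, k ≠ 0 → ∃ r : R, r • i k = i 1 := fun k hk => by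
    obtain ⟨r, hr⟩ := IsLocalRing.residue_surjective k⁻¹
    refine ⟨r, ?_⟩
    rw [← map_smul, Algebra.smul_def, ResidueField.algebraMap_eq, hr, inv_mul_cancel₀ hk]
  -- A nonzero kernel would meet the socle of E by essentiality, hence contain `i 1`.
  have hinj : Function.Injective h := by
    rw [← LinearMap.ker_eq_bot]
    by_contra hne
    obtain ⟨_, ⟨hy, k, rfl⟩, hy0⟩ := Submodule.exists_mem_ne_zero_of_ne_bot
      (hess ((LinearMap.ker h).restrictScalars R) (by simpa using hne))
    obtain ⟨r, hr⟩ := hres k (by rintro rfl; exact hy0 (map_zero i))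
    refine hh ?_
    rw [← hr, ← algebraMap_smul (LocalCompletion R) r (i k), map_smul]
    rw [show h (i k) = 0 from hy, smul_zero]
  obtain ⟨p, hp⟩ := hE.injective.out (h.restrictScalars R) hinj LinearMap.id
  -- The retraction `p` is only R-linear a priori, but on each torsion element `a` acts as some `r :
  -- R`.
  have hlin : ∀ (a : LocalCompletion R) (y : E'), p (a • y) = a • p y := fun a y => by
    obtain ⟨n, hn⟩ := IsInjectiveHull.exists_pow_smul_eq_zero (R := LocalCompletion R) y
    have hn' : ∀ c ∈ maximalIdeal R ^ n, c • y = 0 := fun c hc => by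
      rw [← algebraMap_smul (LocalCompletion R) c y]
      refine hn _ ?_
      rw [AdicCompletion.maximalIdeal_eq_map, ← Ideal.map_pow]
      exact Ideal.mem_map_of_mem _ hc
    obtain ⟨r, hr⟩ := AdicTorsion.exists_rep n a
    have h1 : a - algebraMap R (LocalCompletion R) r ∈ maximalIdeal (LocalCompletion R) ^ n := by
      have h2 := mem_pow_smul_top_of_evalₐ_eq_zero (n := n)
        (a := a - algebraMap R (LocalCompletion R) r)
        (by rw [map_sub, ← hr, AlgHom.commutes]; exact sub_self _)
      rw [AdicCompletion.maximalIdeal_eq_map, ← Ideal.map_pow]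
      rwa [Ideal.smul_top_eq_map] at h2
    have h3 := hn _ h1
    rw [sub_smul, sub_eq_zero, algebraMap_smul] at h3
    rw [h3, map_smul]
    refine (completion_smul_eq (fun c hc => ?_) hr).symm
    rw [← map_smul, hn' c hc, map_zero]
  let p' : E' →ₗ[LocalCompletion R] E := { p with map_smul' := hlin }
  refine ⟨LinearEquiv.ofBijective p' ⟨?_, fun e => ⟨h e, hp e⟩⟩⟩
  rw [← LinearMap.ker_eq_bot]
  by_contra hne
  obtain ⟨_, ⟨hy, k, rfl⟩, hy0⟩ := Submodule.exists_mem_ne_zero_of_ne_bot (hess' _ hne)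
  -- `h (i 1)` lies in the one-dimensional socle of E', so it is a multiple of the kernel element
  -- `i' k`; applying `p` would give `i 1 = 0`.
  obtain ⟨l, hl⟩ := mem_range_of_forall_maximalIdeal_smul_eq_zero hess' (e := h (i 1))
    fun c hc => by
      rw [← map_smul, maximalIdeal_completion_smul_eq_zero (fun c hc => ?_) hc, map_zero]
      rw [← map_smul, maximalIdeal_smul_residueField hc, map_zero]
  have hk : k ≠ 0 := by rintro rfl; exact hy0 (map_zero i')
  obtain ⟨r, hr⟩ := IsLocalRing.residue_surjective (l * k⁻¹)
  refine hi0 ((hp (i 1)).symm.trans ?_)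
  have h4 : h (i 1) = r • i' k := by
    rw [← hl, ← map_smul, Algebra.smul_def, ResidueField.algebraMap_eq, hr,
      inv_mul_cancel_right₀ hk]
  change p' (h (i 1)) = 0
  rw [h4, map_smul, show p' (i' k) = 0 from hy, smul_zero]

end Completion

/-! ### The double Matlis dual of Q. -/

section FractionFieldDual

variable {R : Type u} [CommRing R] [IsLocalRing R] [IsNoetherianRing R]
  {Q : Type u} [Field Q] [Algebra R Q] [IsFractionRing R Q]

theorem exists_eq_tmul_inv_pow [IsDomain R] (hdim : ringKrullDim R = 1) {x : R} (hx : x ∈ maximalIdeal R)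
    (hx0 : x ≠ 0) {A : Type u} [CommRing A] [Algebra R A] (z : A ⊗[R] Q) :
    ∃ (a : A) (n : ℕ), z = a ⊗ₜ (algebraMap R Q x ^ n)⁻¹ := by
  have hx' : algebraMap R Q x ≠ 0 := by rwa [Ne, IsFractionRing.to_map_eq_zero_iff]
  have hstep : ∀ (a : A) (n k : ℕ), a ⊗ₜ[R] (algebraMap R Q x ^ n)⁻¹ =
      (x ^ k • a) ⊗ₜ[R] (algebraMap R Q x ^ (n + k))⁻¹ := fun a n k => by
    rw [smul_tmul, Algebra.smul_def, map_pow, pow_add]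
    congr 1
    field_simp
  induction z with
  | zero => exact ⟨0, 0, (zero_tmul _ _).symm⟩
  | tmul a q =>
    obtain ⟨n, r, hr⟩ := exists_eq_div_pow hdim hx q
    refine ⟨r • a, n, ?_⟩
    rw [smul_tmul, Algebra.smul_def, ← hr]
    congr 1
    field_simp
  | add z w hz hw =>
    obtain ⟨a, n, rfl⟩ := hz
    obtain ⟨b, k, rfl⟩ := hw
    refine ⟨x ^ k • a + x ^ n • b, n + k, ?_⟩
    rw [hstep a n k, hstep b k n, add_comm k n, add_tmul]

variable {E : Type u} [AddCommGroup E] [Module R E] [hE : IsInjectiveHull R (ResidueField R) E]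

/-- Evaluation of linear maps `Q → E` at an element of `Q`, linear over the completion. -/
noncomputable def completionEval (q : Q) : (Q →ₗ[R] E) →ₗ[LocalCompletion R] E where
  toFun f := f q
  map_add' _ _ := rfl
  map_smul' _ _ := rfl

theorem completionEval_surjective {q : Q} (hq : q ≠ 0) :
    Function.Surjective (completionEval q : (Q →ₗ[R] E) →ₗ[LocalCompletion R] E) := fun e => by
  have hinj : Function.Injective (LinearMap.toSpanSingleton R Q q) := by
    rw [injective_iff_map_eq_zero]
    intro r hr
    rw [LinearMap.toSpanSingleton_apply, Algebra.smul_def] at hr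
    exact (IsFractionRing.to_map_eq_zero_iff).mp ((mul_eq_zero.mp hr).resolve_right hq)
  obtain ⟨f, hf⟩ := hE.injective.out _ hinj (LinearMap.toSpanSingleton R E e)
  exact ⟨f, by have := hf 1; rwa [LinearMap.toSpanSingleton_apply_one, LinearMap.toSpanSingleton_apply_one] at this⟩

/-- The submodule of the linear maps `Q → E` that vanish at `1`. -/
noncomputable abbrev vanishingAtOne (R : Type u) [CommRing R] [IsLocalRing R] [IsNoetherianRing R]
    (Q : Type u) [Field Q] [Algebra R Q] (E : Type u) [AddCommGroup E] [Module R E]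
    [IsInjectiveHull R (ResidueField R) E] : Submodule (LocalCompletion R) (Q →ₗ[R] E) :=
  LinearMap.ker (completionEval (1 : Q))

/-- Take g(z) = f(x⁻ⁿz). -/
theorem eq_pow_smul_of_apply_inv_pow_eq_zero {x : R} (hx0 : x ≠ 0) {n : ℕ} {f : Q →ₗ[R] E}
    (hf : f (algebraMap R Q x ^ n)⁻¹ = 0) :
    ∃ g ∈ vanishingAtOne R Q E, f = algebraMap R (LocalCompletion R) x ^ n • g := by
  have hx' : algebraMap R Q x ≠ 0 := by rwa [Ne, IsFractionRing.to_map_eq_zero_iff]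
  refine ⟨f ∘ₗ LinearMap.mulLeft R (algebraMap R Q x ^ n)⁻¹, ?_, ?_⟩
  · change f (_ * 1) = 0
    rwa [mul_one]
  · ext q
    rw [← map_pow, algebraMap_smul, LinearMap.smul_apply, ← map_smul, LinearMap.comp_apply,
      LinearMap.mulLeft_apply, Algebra.smul_def, map_pow]
    congr 1
    field_simp

/-- For q = a/s and g vanishing at 1, s g(q) = a g(1) = 0. Thus one power of the maximal ideal,
depending on q alone, kills every g(q). -/
theorem isHausdorff_vanishingAtOne [IsDomain R] (hdim : ringKrullDim R = 1) :
    IsHausdorff (maximalIdeal (LocalCompletion R)) (vanishingAtOne R Q E) where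
  haus' f hf := by
    ext q
    obtain ⟨a, s, hs, rfl⟩ := IsFractionRing.div_surjective (A := R) q
    have hs0 := nonZeroDivisors.ne_zero hs
    have hs' : algebraMap R Q s ≠ 0 := by rwa [Ne, IsFractionRing.to_map_eq_zero_iff]
    set q := algebraMap R Q a / algebraMap R Q s with hq
    obtain ⟨N, hN⟩ := exists_maximalIdeal_pow_le_span hdim hs0
    have h1 := Submodule.mem_map_of_mem (f := completionEval q ∘ₗ (vanishingAtOne R Q E).subtype)
      (SModEq.zero.mp (hf N))
    rw [Submodule.map_smul''] at h1
    refine (Submodule.mem_bot (LocalCompletion R)).mp (Submodule.smul_le.mpr ?_ h1)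
    rintro c hc _ ⟨g, -, rfl⟩
    rw [Submodule.mem_bot]
    have h2 : maximalIdeal (LocalCompletion R) ^ N ≤
        Ideal.torsionOf (LocalCompletion R) E (g.1 q) := by
      rw [AdicCompletion.maximalIdeal_eq_map, ← Ideal.map_pow]
      refine (Ideal.map_mono hN).trans (Ideal.map_le_iff_le_comap.mpr ?_)
      rw [Ideal.span_singleton_le_iff_mem, Ideal.mem_comap, Ideal.mem_torsionOf_iff,
        algebraMap_smul, ← map_smul]
      have h3 : s • q = a • (1 : Q) := by
        rw [Algebra.smul_def, Algebra.smul_def, hq]; field_simp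
      rw [h3, map_smul, show g.1 1 = 0 from g.2, smul_zero]
    exact h2 hc

/-- The `x`-torsion of E is the dual of `R ⧸ (x)`, which has finite length. -/
theorem fg_of_le_torsion [IsDomain R] (hdim : ringKrullDim R = 1) {x : R} (hx0 : x ≠ 0)
    {N : Submodule (LocalCompletion R) E} (hN : ∀ e ∈ N, x • e = 0) : N.FG := by
  obtain ⟨k, hk⟩ := exists_maximalIdeal_pow_le_span hdim hx0
  have h0 := isFiniteLength_quotient_maximalIdeal_pow hk
  have h1 := Module.length_ne_top_iff.mpr h0
  rw [← h0.length_matlisDual (E := E), Module.length_ne_top_iff,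
    isFiniteLength_iff_isNoetherian_isArtinian] at h1
  have := h1.1
  let g : ((R ⧸ Ideal.span {x}) →ₗ[R] E) →ₗ[R] E :=
    LinearMap.applyₗ (Submodule.Quotient.mk 1)
  have h2 : N.restrictScalars R ≤ LinearMap.range g := fun e he => by
    obtain ⟨f, hf⟩ := exists_quotient_hom_apply_one (J := Ideal.span {x}) (e := e) fun c hc => by
      obtain ⟨r, rfl⟩ := Ideal.mem_span_singleton'.mp hc
      rw [mul_smul, hN e he, smul_zero]
    exact ⟨f, hf⟩
  have h3 : IsNoetherian R (LinearMap.range g) := isNoetherian_of_surjective g.rangeRestrict g.range_rangeRestrict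
  have h4 : IsNoetherian R (N.restrictScalars R) := isNoetherian_of_le h2
  exact Submodule.FG.of_restrictScalars R (Module.Finite.iff_fg.mp inferInstance)

theorem Submodule.exists_fg_sup_ker_eq_top {A M N : Type*} [CommRing A] [AddCommGroup M]
    [Module A M] [AddCommGroup N] [Module A N] {g : M →ₗ[A] N} (hg : (LinearMap.range g).FG) :
    ∃ L : Submodule A M, L.FG ∧ L ⊔ LinearMap.ker g = ⊤ := by
  obtain ⟨t, ht⟩ := hg
  have h1 : ∀ z : t, ∃ y, g y = z := fun z => by
    have : (z : N) ∈ LinearMap.range g := ht ▸ Submodule.subset_span z.2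
    exact this
  choose y hy using h1
  refine ⟨Submodule.span A (Set.range y), Submodule.fg_span (Set.finite_range y), ?_⟩
  rw [← Submodule.comap_map_eq, Submodule.map_span, ← Set.range_comp, eq_top_iff]
  rintro m -
  rw [Submodule.mem_comap, show g ∘ y = Subtype.val from funext hy]
  have : g m ∈ LinearMap.range g := ⟨m, rfl⟩
  rw [← ht] at this
  simpa using this

/-- Evaluation at x⁻¹ sends V into the `x`-torsion of E, so its image is finitely generated; its
kernel lies in xV. Nakayama applies because V is separated. -/
theorem fg_vanishingAtOne [IsDomain R] (hdim : ringKrullDim R = 1) : (vanishingAtOne R Q E).FG := by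
  obtain ⟨x, hx, hx0⟩ := exists_mem_maximalIdeal_ne_zero hdim
  have hx' : algebraMap R Q x ≠ 0 := by rwa [Ne, IsFractionRing.to_map_eq_zero_iff]
  have := isHausdorff_vanishingAtOne (E := E) (Q := Q) hdim
  -- The exponent 1 keeps the form required by `eq_pow_smul_of_apply_inv_pow_eq_zero`.
  let g := completionEval (algebraMap R Q x ^ 1)⁻¹ ∘ₗ (vanishingAtOne R Q E).subtype
  have hfg : (LinearMap.range g).FG := by
    refine fg_of_le_torsion hdim hx0 ?_
    rintro _ ⟨f, rfl⟩
    change x • f.1 _ = 0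
    rw [← map_smul, Algebra.smul_def, pow_one, mul_inv_cancel₀ hx']
    exact f.2
  obtain ⟨L, hL, hLg⟩ := Submodule.exists_fg_sup_ker_eq_top hfg
  have htop := hL.eq_top_of_sup_smul_eq_top (J := maximalIdeal (LocalCompletion R)) <| by
    refine eq_top_iff.mpr (hLg.ge.trans (sup_le_sup_left (fun f hf => ?_) _))
    obtain ⟨f', hf', hff'⟩ := eq_pow_smul_of_apply_inv_pow_eq_zero hx0 hf
    have : f = algebraMap R (LocalCompletion R) x • ⟨f', hf'⟩ := by
      ext1
      simpa using hff'
    rw [this]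
    exact Submodule.smul_mem_smul (algebraMap_mem_maximalIdeal_localCompletion hx)
      Submodule.mem_top
  rw [htop] at hL
  exact (Submodule.fg_top _).mp hL

theorem exists_pow_smul_eq_zero_of_fg {A M : Type*} [CommRing A] [AddCommGroup M] [Module A M]
    {N : Submodule A M} (hN : N.FG) {y : A} (h : ∀ e ∈ N, ∃ n : ℕ, y ^ n • e = 0) :
    ∃ n : ℕ, ∀ e ∈ N, y ^ n • e = 0 := by
  obtain ⟨t, rfl⟩ := hN
  choose! n hn using h
  refine ⟨t.sup n, fun e he => ?_⟩
  have hle : Submodule.span A (t : Set M) ≤ LinearMap.ker (LinearMap.lsmul A M (y ^ t.sup n)) :=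
    Submodule.span_le.mpr fun e he => by
      obtain ⟨k, hk⟩ := Nat.exists_eq_add_of_le' (Finset.le_sup (f := n) he)
      rw [SetLike.mem_coe, LinearMap.mem_ker, LinearMap.lsmul_apply, hk, pow_add, mul_smul,
        hn e (Submodule.subset_span he), smul_zero]
  exact hle he

/-- Every functional on the Matlis dual of `Q`, linear over the completion, is a multiple of the
evaluation at some element of `Q`. -/
theorem exists_eq_smul_completionEval [IsDomain R] (hdim : ringKrullDim R = 1)
    (φ : (Q →ₗ[R] E) →ₗ[LocalCompletion R] E) :
    ∃ (a : LocalCompletion R) (q : Q), φ = a • completionEval q := by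
  obtain ⟨x, hx, hx0⟩ := exists_mem_maximalIdeal_ne_zero hdim
  have hx' : algebraMap R Q x ≠ 0 := by rwa [Ne, IsFractionRing.to_map_eq_zero_iff]
  obtain ⟨n, hn⟩ := exists_pow_smul_eq_zero_of_fg
    ((fg_vanishingAtOne (R := R) (Q := Q) (E := E) hdim).map φ)
    (y := algebraMap R (LocalCompletion R) x) fun e _ => by
      obtain ⟨n, hn⟩ := IsInjectiveHull.exists_pow_smul_eq_zero (R := R) e
      exact ⟨n, by rw [← map_pow, algebraMap_smul]; exact hn _ (Ideal.pow_mem_pow hx n)⟩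
  set q := (algebraMap R Q x ^ n)⁻¹ with hq
  have hq0 : q ≠ 0 := inv_ne_zero (pow_ne_zero n hx')
  have hker : LinearMap.ker (completionEval q) ≤ LinearMap.ker φ := fun f hf => by
    obtain ⟨g, hg, rfl⟩ := eq_pow_smul_of_apply_inv_pow_eq_zero hx0 hf
    rw [LinearMap.mem_ker, map_smul]
    exact hn _ (Submodule.mem_map_of_mem hg)
  -- φ factors through evaluation at `q`; the induced endomorphism of E is a scalar of R̂.
  let ψ : E →ₗ[LocalCompletion R] E := (LinearMap.ker (completionEval q)).liftQ φ hker ∘ₗ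
    ((completionEval q).quotKerEquivOfSurjective (completionEval_surjective hq0)).symm.toLinearMap
  have hψ : ∀ f : Q →ₗ[R] E, ψ (f q) = φ f := fun f => by
    have : ((completionEval q).quotKerEquivOfSurjective
        (completionEval_surjective (R := R) (E := E) hq0)).symm (f q) = Submodule.Quotient.mk f := by
      rw [LinearEquiv.symm_apply_eq]; rfl
    simp only [ψ, LinearMap.comp_apply, LinearEquiv.coe_coe, this]
    rw [Submodule.liftQ_apply]
  obtain ⟨a, ha⟩ := exists_forall_apply_eq_completion_smul (ψ.restrictScalars R)
  exact ⟨a, q, LinearMap.ext fun f => (hψ f).symm.trans (ha (f q))⟩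

/-- Evaluation as a linear map from `Q` to its double Matlis dual. -/
noncomputable def completionEvalₗ (R : Type u) [CommRing R] [IsLocalRing R] [IsNoetherianRing R]
    (Q : Type u) [Field Q] [Algebra R Q] (E : Type u) [AddCommGroup E] [Module R E]
    [IsInjectiveHull R (ResidueField R) E] : Q →ₗ[R] (Q →ₗ[R] E) →ₗ[LocalCompletion R] E where
  toFun := completionEval
  map_add' p q := LinearMap.ext fun f => map_add f p q
  map_smul' r q := LinearMap.ext fun f => map_smul f r q

/-- Every tensor is a ⊗ x⁻ⁿ. If it evaluates to zero, then a kills E, since evaluation at x⁻ⁿ is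
onto E; R̂ acts faithfully on E, so a = 0. -/
theorem nonempty_tensorProduct_equiv_doubleDual [IsDomain R] (hdim : ringKrullDim R = 1) :
    Nonempty (LocalCompletion R ⊗[R] Q ≃ₗ[LocalCompletion R]
      ((Q →ₗ[R] E) →ₗ[LocalCompletion R] E)) := by
  obtain ⟨x, hx, hx0⟩ := exists_mem_maximalIdeal_ne_zero hdim
  have hx' : algebraMap R Q x ≠ 0 := by rwa [Ne, IsFractionRing.to_map_eq_zero_iff]
  refine ⟨LinearEquiv.ofBijective
    (LinearMap.liftBaseChange (LocalCompletion R) (completionEvalₗ R Q E)) ⟨?_, fun φ => ?_⟩⟩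
  · rw [injective_iff_map_eq_zero]
    intro z hz
    obtain ⟨a, n, rfl⟩ := exists_eq_tmul_inv_pow hdim hx hx0 z
    rw [LinearMap.liftBaseChange_tmul] at hz
    suffices a = 0 by rw [this, zero_tmul]
    refine eq_zero_of_forall_completion_smul_eq_zero (E := E) fun e => ?_
    obtain ⟨f, rfl⟩ := completionEval_surjective (R := R) (E := E)
      (inv_ne_zero (pow_ne_zero n hx')) e
    exact LinearMap.congr_fun hz f
  · obtain ⟨a, q, rfl⟩ := exists_eq_smul_completionEval hdim φ
    exact ⟨a ⊗ₜ q, LinearMap.liftBaseChange_tmul _ _ _ _⟩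

end FractionFieldDual

theorem injective_fractionRing (R : Type u) [CommRing R] (Q : Type u) [Field Q] [Algebra R Q]
    [IsFractionRing R Q] : Module.Injective R Q :=
  (Module.Baer.of_smul_bijective fun s hs =>
    smul_bijective_of_isFractionRing (Q := Q) s hs).injective

theorem algebraMap_localCompletion_injective {R : Type u} [CommRing R] [IsLocalRing R]
    [IsNoetherianRing R] : Function.Injective (algebraMap R (LocalCompletion R)) :=
  AdicCompletion.of_injective (maximalIdeal R) R

/-! ### Splitting Q off from R̂ ⊗ Q. -/

section Splitting

variable {R : Type u} [CommRing R] [IsDomain R] [IsLocalRing R] [IsNoetherianRing R]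
  {Q : Type u} [Field Q] [Algebra R Q] [IsFractionRing R Q]

/-- Extending scalars to the completion splits `Q` off. -/
theorem nonempty_tensorProduct_equiv_prod (hdim : ringKrullDim R = 1) :
    Nonempty (LocalCompletion R ⊗[R] Q ≃ₗ[R] Q × CompletionQuotient R) := by
  obtain ⟨x, hx, hx0⟩ := exists_mem_maximalIdeal_ne_zero hdim
  have hx' : algebraMap R Q x ≠ 0 := by rwa [Ne, IsFractionRing.to_map_eq_zero_iff]
  obtain ⟨_, _, -⟩ := existsUnique_module_of_smul_bijective
    (fun s hs => smul_bijective_completionQuotient hdim hs) Q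
  let ι : Q →ₗ[R] LocalCompletion R ⊗[R] Q :=
    (Algebra.TensorProduct.includeRight : Q →ₐ[R] LocalCompletion R ⊗[R] Q).toLinearMap
  have hι : Function.Injective ι := by
    have := IsLocalization.flat Q (nonZeroDivisors R)
    exact Algebra.TensorProduct.includeRight_injective algebraMap_localCompletion_injective
  obtain ⟨ρ, hρ⟩ := (injective_fractionRing R Q).out ι hι LinearMap.id
  let π : LocalCompletion R ⊗[R] Q →ₗ[R] CompletionQuotient R :=
    TensorProduct.lift (((LinearMap.lsmul Q (CompletionQuotient R)).restrictScalars₁₂ R R).flip ∘ₗ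
      (LinearMap.range (Algebra.linearMap R (LocalCompletion R))).mkQ)
  have hπ : ∀ a q, π (a ⊗ₜ q) = q • (Submodule.Quotient.mk a : CompletionQuotient R) :=
    fun a q => rfl
  have hπι : ∀ q, π (ι q) = 0 := fun q => by
    rw [show ι q = 1 ⊗ₜ q from rfl, hπ, (Submodule.Quotient.mk_eq_zero _).mpr, smul_zero]
    exact ⟨1, map_one (algebraMap R _)⟩
  refine ⟨LinearEquiv.ofBijective (ρ.prod π) ⟨?_, ?_⟩⟩
  · rw [injective_iff_map_eq_zero]
    intro z hz
    obtain ⟨a, n, rfl⟩ := exists_eq_tmul_inv_pow hdim hx hx0 z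
    obtain ⟨h1, h2⟩ := Prod.mk.inj hz
    -- x⁻ⁿ is invertible on R̂/R, so `a` comes from R and the tensor lies in ι(Q), where ρ is
    -- injective.
    rw [hπ, smul_eq_zero_iff_right (inv_ne_zero (pow_ne_zero n hx')),
      Submodule.Quotient.mk_eq_zero] at h2
    obtain ⟨r, rfl⟩ := h2
    have h3 : (Algebra.linearMap R (LocalCompletion R) r) ⊗ₜ[R] (algebraMap R Q x ^ n)⁻¹ =
        ι (r • (algebraMap R Q x ^ n)⁻¹) := by
      rw [Algebra.linearMap_apply, Algebra.algebraMap_eq_smul_one, smul_tmul]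
      rfl
    rw [h3] at h1 ⊢
    rw [show r • (algebraMap R Q x ^ n)⁻¹ = 0 from (hρ _).symm.trans h1, map_zero]
  · rintro ⟨q, w⟩
    obtain ⟨a, rfl⟩ := Submodule.Quotient.mk_surjective _ w
    -- The correction from ι(Q) adjusts the first coordinate and is invisible to π.
    refine ⟨ι (q - ρ (a ⊗ₜ 1)) + a ⊗ₜ 1, Prod.ext ?_ ?_⟩
    · change ρ _ = q
      rw [map_add, hρ]
      simp
    · change π _ = _
      rw [map_add, hπι, hπ, one_smul, zero_add]

end Splitting

/-! ### Ext¹ from the long exact sequence. -/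

section ExtOfProjectivePresentation

open CategoryTheory CategoryTheory.Abelian

variable {R : Type u} [CommRing R] {A B C : Type u} [AddCommGroup A] [Module R A]
  [AddCommGroup B] [Module R B] [AddCommGroup C] [Module R C]

/-- `Ext¹` computed from a presentation by a projective module. -/
theorem ModuleExt.exists_surjective_of_projective [Module.Projective R B] {f : A →ₗ[R] B}
    {g : B →ₗ[R] C} (hf : Function.Injective f) (hg : Function.Surjective g)
    (h : Function.Exact f g) (N : Type u) [AddCommGroup N] [Module R N] :
    ∃ δ : (A →ₗ[R] N) →ₗ[R] ModuleExt R C N 1, Function.Surjective δ ∧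
      LinearMap.ker δ = LinearMap.range (LinearMap.lcomp R N f) := by
  let S : ShortComplex (ModuleCat.{u} R) :=
    ShortComplex.mk (ModuleCat.ofHom f) (ModuleCat.ofHom g) (by
      rw [← ModuleCat.ofHom_comp, h.linearMap_comp_eq_zero]; rfl)
  have hS : S.ShortExact :=
    { exact := (ShortComplex.ShortExact.moduleCat_exact_iff_function_exact S).mpr h
      mono_f := (ModuleCat.mono_iff_injective _).mpr hf
      epi_g := (ModuleCat.epi_iff_surjective _).mpr hg }
  let e : (A →ₗ[R] N) ≃ₗ[R] Ext (ModuleCat.of R A) (ModuleCat.of R N) 0 :=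
    (ModuleCat.homLinearEquiv (S := R) (M := ModuleCat.of R A)
      (N := ModuleCat.of R N)).symm ≪≫ₗ Ext.linearEquiv₀.symm
  have he : ∀ φ, e φ = Ext.mk₀ (ModuleCat.ofHom φ) := fun φ => rfl
  let δ : (A →ₗ[R] N) →ₗ[R] ModuleExt R C N 1 :=
    Ext.precompOfLinear hS.extClass R (ModuleCat.of R N) (add_zero 1) ∘ₗ e.toLinearMap
  have hδ : ∀ φ, δ φ = hS.extClass.comp (e φ) (add_zero 1) := fun φ => rfl
  refine ⟨δ, fun y => ?_, le_antisymm (fun φ hφ => ?_) ?_⟩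
  · obtain ⟨z, hz⟩ := Ext.contravariant_sequence_exact₃ hS _ y
      (Ext.eq_zero_of_projective (P := ModuleCat.of R B) _) (add_zero 1)
    exact ⟨e.symm z, by rw [hδ, e.apply_symm_apply, hz]⟩
  · obtain ⟨z, hz⟩ := Ext.contravariant_sequence_exact₁ hS _ (e φ) (add_zero 1) hφ
    obtain ⟨ψ, rfl⟩ := (Ext.mk₀_bijective _ _).2 z
    refine ⟨ψ.hom, e.injective ?_⟩
    rw [← hz, Ext.mk₀_comp_mk₀]
    rfl
  · rintro _ ⟨ψ, rfl⟩
    have : e (LinearMap.lcomp R N f ψ) =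
        (Ext.mk₀ S.f).comp (Ext.mk₀ (ModuleCat.ofHom ψ)) (zero_add 0) := by
      rw [Ext.mk₀_comp_mk₀]; rfl
    rw [LinearMap.mem_ker, hδ, this]
    exact hS.extClass_comp_assoc _

end ExtOfProjectivePresentation

theorem nonempty_linearEquiv_of_ker_eq {R X Y Z : Type*} [CommRing R] [AddCommGroup X] [Module R X]
    [AddCommGroup Y] [Module R Y] [AddCommGroup Z] [Module R Z] {f : X →ₗ[R] Y} {g : X →ₗ[R] Z}
    (hf : Function.Surjective f) (hg : Function.Surjective g)
    (h : LinearMap.ker f = LinearMap.ker g) : Nonempty (Y ≃ₗ[R] Z) :=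
  ⟨(f.quotKerEquivOfSurjective hf).symm ≪≫ₗ Submodule.quotEquivOfEq _ _ h ≪≫ₗ
    g.quotKerEquivOfSurjective hg⟩

/-! ### The telescope presentation of Q = R[1/x]. -/

section Telescope

variable {R : Type u} [CommRing R] (x : R)

/-- The relations `e i = x • e (i + 1)` of the localization of `R` at the powers of `x`. -/
noncomputable def telescopeRel : (ℕ →₀ R) →ₗ[R] (ℕ →₀ R) :=
  LinearMap.id - x • Finsupp.lmapDomain R R Nat.succ

theorem telescopeRel_single (i : ℕ) (a : R) :
    telescopeRel x (Finsupp.single i a) = Finsupp.single i a - Finsupp.single (i + 1) (x * a) := by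
  simp [telescopeRel, Finsupp.mapDomain_single]

theorem telescopeRel_injective : Function.Injective (telescopeRel x) := by
  rw [injective_iff_map_eq_zero]
  intro c hc
  have hc' : ∀ i, c i - x * Finsupp.mapDomain Nat.succ c i = 0 := fun i => DFunLike.congr_fun hc i
  ext i
  induction i with
  | zero =>
    have := hc' 0
    rwa [Finsupp.mapDomain_of_notMem_range _ _ (by simp), mul_zero, sub_zero] at this
  | succ i ih =>
    have := hc' (i + 1)
    rwa [Finsupp.mapDomain_apply Nat.succ_injective, ih, Finsupp.zero_apply, mul_zero,
      sub_zero] at this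

/-- Modulo the relations eₙ = xᵏeₙ₊ₖ, so all terms can be moved to a common index. -/
theorem exists_sub_single_mem_range_telescopeRel (c : ℕ →₀ R) :
    ∃ (n : ℕ) (a : R), c - Finsupp.single n a ∈ LinearMap.range (telescopeRel x) := by
  have hstep : ∀ (k n : ℕ) (a : R), Finsupp.single n a - Finsupp.single (n + k) (x ^ k * a) ∈
      LinearMap.range (telescopeRel x) := fun k n a => by
    induction k with
    | zero => simp
    | succ k ih =>
      have := add_mem ih ⟨Finsupp.single (n + k) (x ^ k * a), telescopeRel_single x _ _⟩
      rwa [sub_add_sub_cancel, ← mul_assoc, ← pow_succ'] at this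
  induction c using Finsupp.induction_linear with
  | zero => exact ⟨0, 0, by simp⟩
  | add c d hc hd =>
    obtain ⟨n, a, hn⟩ := hc
    obtain ⟨m, b, hm⟩ := hd
    refine ⟨n + m, x ^ m * a + x ^ n * b, ?_⟩
    convert! add_mem (add_mem hn (hstep m n a)) (add_mem hm (hstep n m b)) using 1
    rw [Finsupp.single_add, add_comm m n]
    abel
  | single n a => exact ⟨n, a, by simp⟩

variable (Q : Type u) [Field Q] [Algebra R Q] [IsFractionRing R Q]

/-- The map `e i ↦ 1 / x ^ i` onto the localization of `R` at the powers of `x`. -/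
noncomputable def telescopeMap : (ℕ →₀ R) →ₗ[R] Q :=
  Finsupp.linearCombination R fun i => (algebraMap R Q x ^ i)⁻¹

theorem telescope_exact {x : R} (hx0 : x ≠ 0) :
    Function.Exact (telescopeRel x) (telescopeMap x Q) := by
  have hx' : algebraMap R Q x ≠ 0 := by rwa [Ne, IsFractionRing.to_map_eq_zero_iff]
  have hzero : ∀ d, telescopeMap x Q (telescopeRel x d) = 0 := fun d => by
    induction d using Finsupp.induction_linear with
    | zero => simp
    | add c d hc hd => rw [map_add, map_add, hc, hd, add_zero]
    | single n a =>
      rw [telescopeRel_single, map_sub, telescopeMap, Finsupp.linearCombination_single,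
        Finsupp.linearCombination_single, Algebra.smul_def, Algebra.smul_def, map_mul, pow_succ]
      field_simp
      ring
  intro c
  refine ⟨fun hc => ?_, ?_⟩
  · obtain ⟨n, a, d, hd⟩ := exists_sub_single_mem_range_telescopeRel x c
    have h1 := congrArg (telescopeMap x Q) hd
    rw [hzero, map_sub, hc, zero_sub, eq_comm, neg_eq_zero, telescopeMap,
      Finsupp.linearCombination_single, Algebra.smul_def, mul_eq_zero,
      IsFractionRing.to_map_eq_zero_iff] at h1
    obtain rfl := h1.resolve_right (inv_ne_zero (pow_ne_zero n hx'))
    exact ⟨d, by simpa using hd⟩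
  · rintro ⟨d, rfl⟩
    exact hzero d

end Telescope

/-! ### The sums ∑ xⁱbᵢ in the completion. -/

section PowerSum

variable {R : Type u} [CommRing R] [IsLocalRing R]

theorem exists_sum_pow_mul (x : R) (hx : x ∈ maximalIdeal R) :
    ∃ s : (ℕ → R) →ₗ[R] LocalCompletion R, ∀ b n,
      AdicCompletion.evalₐ (maximalIdeal R) n (s b) =
        Ideal.Quotient.mk _ (∑ i ∈ Finset.range n, x ^ i * b i) := by
  have hcauchy : ∀ (b : ℕ → R) {m n : ℕ}, m ≤ n →
      ∑ i ∈ Finset.range m, x ^ i * b i ≡ ∑ i ∈ Finset.range n, x ^ i * b i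
        [SMOD (maximalIdeal R ^ m • ⊤ : Ideal R)] := fun b m n hmn => by
    rw [SModEq.comm, SModEq.sub_mem, smul_eq_mul, Ideal.mul_top, ← Finset.sum_Ico_eq_sub _ hmn]
    exact sum_mem fun i hi => Ideal.mul_mem_right _ _
      (Ideal.pow_le_pow_right (Finset.mem_Ico.mp hi).1 (Ideal.pow_mem_pow hx i))
  have hs : ∀ b n, AdicCompletion.evalₐ (maximalIdeal R) n (AdicCompletion.mk (maximalIdeal R) R
      ⟨fun n => ∑ i ∈ Finset.range n, x ^ i * b i, hcauchy b⟩) =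
        Ideal.Quotient.mk _ (∑ i ∈ Finset.range n, x ^ i * b i) := fun b n =>
    AdicCompletion.evalₐ_mk _ n _
  refine ⟨
    { toFun := fun b => AdicCompletion.mk (maximalIdeal R) R
        ⟨fun n => ∑ i ∈ Finset.range n, x ^ i * b i, hcauchy b⟩
      map_add' := fun b c => ?_
      map_smul' := fun r b => ?_ }, hs⟩
  · refine AdicCompletion.ext_evalₐ fun n => ?_
    rw [map_add, hs, hs, hs, ← map_add, ← Finset.sum_add_distrib]
    simp only [Pi.add_apply, mul_add]
  · refine AdicCompletion.ext_evalₐ fun n => ?_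
    rw [RingHom.id_apply, map_smul, hs, hs,
      Algebra.smul_def r (Ideal.Quotient.mk (maximalIdeal R ^ n) _), Ideal.Quotient.algebraMap_eq,
      ← map_mul, Finset.mul_sum]
    simp only [Pi.smul_apply, smul_eq_mul, mul_left_comm]

theorem sum_pow_mul_eq {x : R} (hx : x ∈ maximalIdeal R) {s : (ℕ → R) →ₗ[R] LocalCompletion R}
    (hs : ∀ b n, AdicCompletion.evalₐ (maximalIdeal R) n (s b) =
      Ideal.Quotient.mk _ (∑ i ∈ Finset.range n, x ^ i * b i)) (b : ℕ → R) :
    s b = algebraMap R (LocalCompletion R) (b 0) + x • s fun i => b (i + 1) := by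
  refine AdicCompletion.ext_evalₐ fun n => ?_
  rw [map_add, map_smul, hs, hs, AlgHom.commutes, Algebra.smul_def,
    Ideal.Quotient.algebraMap_eq, ← map_mul, ← map_add, Finset.mul_sum]
  have h1 := Finset.sum_range_succ' (fun i => x ^ i * b i) n
  rw [Finset.sum_range_succ] at h1
  refine Ideal.Quotient.eq.mpr ?_
  -- The truncations of the two sides differ by the single term xⁿbₙ, which vanishes modulo `𝔪 ^ n`.
  have h2 : ∑ i ∈ Finset.range n, x ^ i * b i -
      (b 0 + ∑ i ∈ Finset.range n, x * (x ^ i * b (i + 1))) = - (x ^ n * b n) := by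
    rw [eq_sub_of_add_eq h1]
    simp only [pow_succ', mul_assoc, pow_zero, one_mul]
    ring
  rw [h2]
  exact neg_mem (Ideal.mul_mem_right _ _ (Ideal.pow_mem_pow hx n))

end PowerSum

/-! ### Identification of Ext¹(Q, R) with R̂/R. -/

section ExtOfFractionField

variable {R : Type u} [CommRing R] [IsDomain R] [IsLocalRing R] [IsNoetherianRing R]

theorem telescopeMap_surjective (hdim : ringKrullDim R = 1) {x : R} (hx : x ∈ maximalIdeal R)
    (hx0 : x ≠ 0) (Q : Type u) [Field Q] [Algebra R Q] [IsFractionRing R Q] :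
    Function.Surjective (telescopeMap x Q) := fun q => by
  have hx' : algebraMap R Q x ≠ 0 := by rwa [Ne, IsFractionRing.to_map_eq_zero_iff]
  obtain ⟨n, a, h⟩ := exists_eq_div_pow hdim hx q
  refine ⟨Finsupp.single n a, ?_⟩
  rw [telescopeMap, Finsupp.linearCombination_single, Algebra.smul_def, ← h]
  field_simp

/-- Iterating a = r(a) + x t(a) gives an x-adic expansion with digits r(tⁿa); the error is divisible
by every xⁿ. -/
theorem sum_pow_mul_surjective (hdim : ringKrullDim R = 1) {x : R} (hx : x ∈ maximalIdeal R)
    (hx0 : x ≠ 0) {s : (ℕ → R) →ₗ[R] LocalCompletion R}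
    (hs : ∀ b n, AdicCompletion.evalₐ (maximalIdeal R) n (s b) =
      Ideal.Quotient.mk _ (∑ i ∈ Finset.range n, x ^ i * b i)) : Function.Surjective s := fun a => by
  choose r t hrt using exists_eq_algebraMap_add_smul hdim hx0
  refine ⟨fun n => r (t^[n] a), ?_⟩
  have key : ∀ n a, ∃ d, s (fun n => r (t^[n] a)) - a = x ^ n • d := fun n => by
    induction n with
    | zero => exact fun a => ⟨_, by rw [pow_zero, one_smul]⟩
    | succ n ih =>
      intro a
      obtain ⟨d, hd⟩ := ih (t a)
      refine ⟨d, ?_⟩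
      rw [pow_succ', mul_smul, ← hd, sum_pow_mul_eq hx hs, smul_sub]
      nth_rw 3 [hrt a]
      simp only [Function.iterate_succ, Function.comp_apply, Function.iterate_zero, id_eq]
      abel
  rw [← sub_eq_zero]
  refine AdicCompletion.ext_evalₐ fun n => ?_
  obtain ⟨d, hd⟩ := key n a
  rw [hd, map_smul, map_zero, Algebra.smul_def, Ideal.Quotient.algebraMap_eq,
    Ideal.Quotient.eq_zero_iff_mem.mpr (Ideal.pow_mem_pow hx n), zero_mul]

/-- If the sum lies in R, so do all tails cₙ = ∑ xⁱbᵢ₊ₙ, as xR̂ ∩ R = xR, and cₙ = bₙ + x cₙ₊₁.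
Conversely the sum telescopes to c₀. -/
theorem sum_pow_mul_mem_range_iff (hdim : ringKrullDim R = 1) {x : R} (hx : x ∈ maximalIdeal R)
    (hx0 : x ≠ 0) {s : (ℕ → R) →ₗ[R] LocalCompletion R}
    (hs : ∀ b n, AdicCompletion.evalₐ (maximalIdeal R) n (s b) =
      Ideal.Quotient.mk _ (∑ i ∈ Finset.range n, x ^ i * b i)) (b : ℕ → R) :
    (∃ r, algebraMap R (LocalCompletion R) r = s b) ↔
      ∃ c : ℕ → R, ∀ n, b n = c n - x * c (n + 1) := by
  constructor
  · rintro ⟨r, hr⟩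
    have key : ∀ n, ∃ c, algebraMap R (LocalCompletion R) c = s fun i => b (i + n) := fun n => by
      induction n with
      | zero => exact ⟨r, hr⟩
      | succ n ih =>
        obtain ⟨c, hc⟩ := ih
        rw [sum_pow_mul_eq hx hs, ← sub_eq_iff_eq_add', ← map_sub] at hc
        obtain ⟨d, -, hd⟩ := mem_range_algebraMap_of_smul_mem hdim hx0 hc.symm
        exact ⟨d, by rw [← hd]; simp only [add_assoc, add_comm 1 n]⟩
    choose c hc using key
    refine ⟨c, fun n => algebraMap_localCompletion_injective ?_⟩
    rw [map_sub, map_mul, hc, hc, sum_pow_mul_eq hx hs fun i => b (i + n), zero_add,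
      Algebra.smul_def]
    simp only [add_assoc, add_comm 1 n]
    ring
  · rintro ⟨c, hc⟩
    refine ⟨c 0, ?_⟩
    have hb : b = c - x • fun n => c (n + 1) := funext hc
    rw [hb, map_sub, map_smul, sum_pow_mul_eq hx hs c, add_sub_cancel_right]

/-- Both sides are quotients of the dual of the free module, read by `v` as sequences, with the same
kernel. -/
theorem nonempty_completionQuotient_equiv_ext (hdim : ringKrullDim R = 1) (Q : Type u) [Field Q]
    [Algebra R Q] [IsFractionRing R Q] :
    Nonempty (CompletionQuotient R ≃ₗ[R] ModuleExt R Q R 1) := by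
  obtain ⟨x, hx, hx0⟩ := exists_mem_maximalIdeal_ne_zero hdim
  obtain ⟨s, hs⟩ := exists_sum_pow_mul x hx
  obtain ⟨δ, hδ, hker⟩ := ModuleExt.exists_surjective_of_projective (telescopeRel_injective x)
    (telescopeMap_surjective hdim hx hx0 Q) (telescope_exact Q hx0) R
  let v : ((ℕ →₀ R) →ₗ[R] R) →ₗ[R] (ℕ → R) :=
    LinearMap.pi fun i => LinearMap.applyₗ (Finsupp.single i 1)
  have hv : Function.Surjective v := fun b =>
    ⟨Finsupp.linearCombination R b, funext fun i => by simp [v]⟩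
  refine nonempty_linearEquiv_of_ker_eq
    (f := (LinearMap.range (Algebra.linearMap R (LocalCompletion R))).mkQ ∘ₗ s ∘ₗ v)
    ((Submodule.mkQ_surjective _).comp ((sum_pow_mul_surjective hdim hx hx0 hs).comp hv)) hδ ?_
  rw [hker]
  ext φ
  rw [LinearMap.mem_ker, LinearMap.comp_apply, Submodule.mkQ_apply, Submodule.Quotient.mk_eq_zero]
  refine (sum_pow_mul_mem_range_iff hdim hx hx0 hs (v φ)).trans ⟨?_, ?_⟩
  · rintro ⟨c, hc⟩
    refine ⟨Finsupp.linearCombination R c, Finsupp.lhom_ext fun i a => ?_⟩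
    have h1 : φ (Finsupp.single i a) = a * v φ i := by
      change _ = a • φ (Finsupp.single i 1)
      rw [← map_smul, Finsupp.smul_single_one]
    rw [h1, hc, LinearMap.lcomp_apply, telescopeRel_single, map_sub,
      Finsupp.linearCombination_single, Finsupp.linearCombination_single, smul_eq_mul, smul_eq_mul]
    ring
  · rintro ⟨ψ, rfl⟩
    refine ⟨v ψ, fun n => ?_⟩
    change ψ (telescopeRel x (Finsupp.single n 1)) = ψ (Finsupp.single n 1) -
      x • ψ (Finsupp.single (n + 1) 1)
    rw [telescopeRel_single, map_sub, ← map_smul, Finsupp.smul_single]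
    rfl

end ExtOfFractionField

/-! ### Completeness and self-duality of Q. -/

section Complete

variable {R : Type u} [CommRing R] [IsLocalRing R] [IsNoetherianRing R]

theorem isAdicComplete_iff_subsingleton_completionQuotient :
    IsAdicComplete (maximalIdeal R) R ↔ Subsingleton (CompletionQuotient R) := by
  rw [← AdicCompletion.of_bijective_iff, Submodule.Quotient.subsingleton_iff,
    LinearMap.range_eq_top]
  exact and_iff_right algebraMap_localCompletion_injective

variable [IsDomain R] {Q : Type u} [Field Q] [Algebra R Q] [IsFractionRing R Q]
  {E : Type u} [AddCommGroup E] [Module R E] [hE : IsInjectiveHull R (ResidueField R) E]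

/-- If `R` is complete, then the Matlis dual of `Q` is one-dimensional over `Q`. -/
theorem nonempty_matlisDual_equiv_of_complete (hdim : ringKrullDim R = 1)
    (hR : Function.Surjective (algebraMap R (LocalCompletion R))) :
    Nonempty (MatlisDual R E Q ≃ₗ[R] Q) := by
  obtain ⟨e, he⟩ := exists_hom_ne_zero (R := R) (E := E) (one_ne_zero (α := ResidueField R))
  obtain ⟨h, hh⟩ := completionEval_surjective (R := R) (one_ne_zero (α := Q)) (e 1)
  replace hh : h 1 ≠ 0 := fun h0 => he (hh.symm.trans h0)
  let ι : Q →ₗ[R] (Q →ₗ[R] E) := LinearMap.compRight R h ∘ₗ LinearMap.mul R Q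
  have hι : ∀ p q, ι p q = h (p * q) := fun _ _ => rfl
  have hιinj : Function.Injective ι := by
    rw [injective_iff_map_eq_zero]
    intro p hp
    by_contra hp0
    have := LinearMap.congr_fun hp p⁻¹
    rw [hι, mul_inv_cancel₀ hp0] at this
    exact hh this
  obtain ⟨p, hp⟩ := (injective_fractionRing R Q).out ι hιinj LinearMap.id
  -- h ∘ p is linear over R̂ because R surjects onto R̂, so it must be evaluation at an element of
  -- Q.
  let φ : (Q →ₗ[R] E) →ₗ[LocalCompletion R] E :=
    { toFun := fun f => h (p f)
      map_add' := fun f g => by rw [map_add, map_add]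
      map_smul' := fun a f => by
        obtain ⟨r, rfl⟩ := hR a
        rw [algebraMap_smul, map_smul, map_smul, RingHom.id_apply, algebraMap_smul] }
  obtain ⟨a, q, hφ⟩ := exists_eq_smul_completionEval hdim φ
  obtain ⟨r, rfl⟩ := hR a
  have hφ' : ∀ f : Q →ₗ[R] E, h (p f) = f (r • q) := fun f => by
    rw [map_smul, ← algebraMap_smul (LocalCompletion R) r (f q)]
    exact LinearMap.congr_fun hφ f
  -- Testing on ι(c) shows that h kills c(1 - rq) for all c; a nonzero 1 - rq would give h(1) = 0.
  have hq : r • q = 1 := by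
    have h1 : ∀ c, h (c - c * r • q) = 0 := fun c => by
      have := hφ' (ι c)
      rw [hp, hι] at this
      rw [map_sub, ← this]
      exact sub_self _
    by_contra hq
    refine hh ?_
    have h2 : (1 : Q) - r • q ≠ 0 := sub_ne_zero.mpr (Ne.symm hq)
    have := h1 (1 - r • q)⁻¹
    rwa [← mul_one_sub, inv_mul_cancel₀ h2] at this
  have hmul : ∀ (f : Q →ₗ[R] E) (c : Q), p (f ∘ₗ LinearMap.mulLeft R c) = c * p f := fun f c => by
    obtain ⟨a, s, hs, rfl⟩ := IsFractionRing.div_surjective (A := R) c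
    have hs' : algebraMap R Q s ≠ 0 := IsFractionRing.to_map_ne_zero_of_mem_nonZeroDivisors hs
    refine mul_left_cancel₀ hs' ?_
    rw [← Algebra.smul_def, ← map_smul, ← mul_assoc, mul_div_cancel₀ _ hs', ← Algebra.smul_def,
      ← map_smul]
    congr 1
    ext z
    simp only [LinearMap.smul_apply, LinearMap.comp_apply, LinearMap.mulLeft_apply, ← map_smul,
      Algebra.smul_def]
    congr 1
    field_simp
  -- Since p turns precomposition with c into multiplication by c, f(c) = h(c p(f)), that is, f =
  -- ι(p f).
  have hsurj : Function.Surjective ι := fun f => by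
    refine ⟨p f, LinearMap.ext fun c => ?_⟩
    have := hφ' (f ∘ₗ LinearMap.mulLeft R c)
    rw [hmul, hq, LinearMap.comp_apply, LinearMap.mulLeft_apply, mul_one] at this
    rw [hι, mul_comm, this]
  exact ⟨(LinearEquiv.ofBijective ι ⟨hιinj, hsurj⟩).symm⟩

/-- The R̂-linear double dual embeds in the R-linear one, which is isomorphic to Q when D(Q) ≅ Q. So
Q × R̂/R embeds in Q. -/
theorem subsingleton_completionQuotient_of_matlisDual_equiv (hdim : ringKrullDim R = 1)
    (e : MatlisDual R E Q ≃ₗ[R] Q) : Subsingleton (CompletionQuotient R) := by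
  obtain ⟨e₁⟩ := nonempty_tensorProduct_equiv_prod (R := R) (Q := Q) hdim
  obtain ⟨e₂⟩ := nonempty_tensorProduct_equiv_doubleDual (R := R) (Q := Q) (E := E) hdim
  let k : ((Q →ₗ[R] E) →ₗ[LocalCompletion R] E) →ₗ[R] ((Q →ₗ[R] E) →ₗ[R] E) :=
    LinearMap.restrictScalarsₗ R (LocalCompletion R) (Q →ₗ[R] E) E R
  let ψ : (Q × CompletionQuotient R) →ₗ[R] Q :=
    e.toLinearMap ∘ₗ (LinearMap.lcomp R E e.symm.toLinearMap) ∘ₗ k ∘ₗ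
      (e₂.restrictScalars R).toLinearMap ∘ₗ e₁.symm.toLinearMap
  have hψ : Function.Injective ψ :=
    e.injective.comp <| (lcomp_injective_of_surjective e.symm.surjective).comp <|
      (LinearMap.restrictScalars_injective R).comp <| e₂.injective.comp e₁.symm.injective
  refine subsingleton_of_forall_eq 0 fun w => ?_
  by_contra hw
  -- Any two elements of Q are R-dependent, so a nonzero `w` would give s(1, 0) = a(0, w) with s ≠
  -- 0.
  obtain ⟨a, s, hs, h⟩ := IsFractionRing.div_surjective (A := R) (ψ (1, 0) / ψ (0, w))
  have hs' : algebraMap R Q s ≠ 0 := IsFractionRing.to_map_ne_zero_of_mem_nonZeroDivisors hs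
  have hw' : ψ (0, w) ≠ 0 := fun h0 => hw (Prod.mk.inj (hψ (h0.trans (map_zero ψ).symm))).2
  have h1 : ψ (s • (1, 0)) = ψ (a • (0, w)) := by
    rw [map_smul, map_smul, Algebra.smul_def, Algebra.smul_def]
    field_simp at h
    rw [← h, mul_comm]
  have h2 := (Prod.mk.inj (hψ h1)).1
  rw [smul_zero, Algebra.smul_def, mul_one] at h2
  exact hs' h2

end Complete

end

open IsLocalRing TensorProduct in
theorem theorem3p2 {R : Type u} [CommRing R] [IsDomain R] [IsLocalRing R] [IsNoetherianRing R]
    (hdim : ringKrullDim R = 1)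
    {Q : Type u} [Field Q] [Algebra R Q] [IsFractionRing R Q]
    {E : Type u} [AddCommGroup E] [Module R E] [IsInjectiveHull R (ResidueField R) E]
    {E' : Type u} [AddCommGroup E'] [Module (LocalCompletion R) E']
    [IsInjectiveHull (LocalCompletion R) (ResidueField (LocalCompletion R)) E'] :
    Nonempty (MatlisDual (LocalCompletion R) E' (MatlisDual R E Q)
      ≃ₗ[LocalCompletion R] LocalCompletion R ⊗[R] Q) ∧
    Nonempty (LocalCompletion R ⊗[R] Q ≃ₗ[R] Q × CompletionQuotient R) ∧
    Nonempty (CompletionQuotient R ≃ₗ[R] ModuleExt R Q R 1) ∧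
    (∃! _ : Module Q (CompletionQuotient R), IsScalarTower R Q (CompletionQuotient R)) ∧
    Module.Injective R (CompletionQuotient R) ∧
    (IsAdicComplete (maximalIdeal R) R ↔ Subsingleton (ModuleExt R Q R 1)) ∧
    (Subsingleton (ModuleExt R Q R 1) ↔ Nonempty (MatlisDual R E Q ≃ₗ[R] Q)) := by
  have := isNoetherianRing_localCompletion hdim
  obtain ⟨e⟩ := nonempty_equiv_injectiveHull_completion (R := R) (E := E) (E' := E')
  obtain ⟨e₁⟩ := nonempty_tensorProduct_equiv_doubleDual (R := R) (Q := Q) (E := E) hdim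
  obtain ⟨e₂⟩ := nonempty_completionQuotient_equiv_ext hdim Q
  have hbij := fun s hs => smul_bijective_completionQuotient (R := R) hdim (s := s) hs
  have hsub : Subsingleton (ModuleExt R Q R 1) ↔ Subsingleton (CompletionQuotient R) :=
    e₂.symm.toEquiv.subsingleton_congr
  refine ⟨⟨e.congrRight ≪≫ₗ e₁.symm⟩, nonempty_tensorProduct_equiv_prod hdim, ⟨e₂⟩,
    existsUnique_module_of_smul_bijective hbij Q, (Module.Baer.of_smul_bijective hbij).injective,
    isAdicComplete_iff_subsingleton_completionQuotient.trans hsub.symm, hsub.trans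
      ⟨fun h => nonempty_matlisDual_equiv_of_complete hdim ?_, fun ⟨e⟩ =>
        subsingleton_completionQuotient_of_matlisDual_equiv hdim e⟩⟩
  exact LinearMap.range_eq_top.mp (Submodule.Quotient.subsingleton_iff.mp h)
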